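/- For a compactly supported probability measure $\mu$ on $\mathbb{R}$ put $G_\mu(z)=\int_{\mathbb{R}}\frac{d\mu(t)}{z-t}$ for $z\in\mathbb{C}$ outside the support of $\mu$. The $R$-transform of $\mu$ is the germ at $0$ of the analytic function $R_\mu$ such that $G_\mu\bigl(\frac1z+R_\mu(z)\bigr)=z$ for all $z\neq 0$ close to $0$. Theorem. Let $0<\lambda<1$ and $0<r<\frac{\sqrt{\lambda}}{1-\lambda}$, and let $U=\{z\in\mathbb{C} : |z-\frac{1}{1-\lambda}|>r\}$. Call a function $f:U\to\mathbb{C}$ admissible if it is analytic on $U$, satisfies $f(\overline{z})=\overline{f(z)}$ for all $z\in U$, and $\lim_{|z|\to\infty} z f'(z)=\lim_{|z|\to\infty} f(z)=0$. (a) Let $(f_n)_{n\in\mathbb{N}}$ be a sequence of admissible functions that converges to $0$ uniformly on $U$. Then for all sufficiently large $n$, the function $z\mapsto\frac{\lambda}{1-z}+f_n(z)$ is (near $0$) the $R$-transform of a compactly supported probability measure on $\mathbb{R}$. (b) Consequently, the set of $R$-transforms of compactly supported probability measures contains a neighborhood of the free Poisson $R$-transform $z\mapsto\frac{\lambda}{1-z}$,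 in the following sense: there is $\varepsilon>0$, depending only on $\lambda$ and $r$, such that for every admissible $f$ with $|f(z)|<\varepsilon$ for all $z\in U$, the function $z\mapsto\frac{\lambda}{1-z}+f(z)$ is (near $0$) the $R$-transform of a compactly supported probability measure on $\mathbb{R}$. -/

import Mathlib

open Filter Topology MeasureTheory

/-- The Cauchy transform `G_μ(z) = ∫ dμ(t) / (z - t)` of a measure on the real line
(meaningful for `z` off the support of `μ`). -/
noncomputable def cauchyTransform (μ : Measure ℝ) (z : ℂ) : ℂ :=
  ∫ t : ℝ, 1 / (z - (t : ℂ)) ∂μ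

/-- `R` is (on a neighbourhood of `0`) the `R`-transform of the compactly supported
probability measure `μ` on the real line: `R` is analytic at `0`, and `K(z) = 1 / z + R(z)`
satisfies `G_μ(K(z)) = z` for all `z ≠ 0` close to `0`.  As `R` is bounded near `0`, `K(z)`
tends to infinity there, so `K` is the inverse of `G_μ` near infinity and the germ of `R` at
`0` is determined by `μ`. -/
def IsRTransform (μ : Measure ℝ) (R : ℂ → ℂ) : Prop :=
  AnalyticAt ℂ R 0 ∧ ∀ᶠ z in 𝓝[≠] (0 : ℂ), cauchyTransform μ (1 / z + R z) = z

/-- `R` is the `R`-transform of a compactly supported probability measure on the real line. -/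
def IsRTransformOfCompactlySupported (R : ℂ → ℂ) : Prop :=
  ∃ μ : Measure ℝ, IsProbabilityMeasure μ ∧ IsCompact μ.support ∧ IsRTransform μ R

/-- The exterior of the closed disc with centre `1 / (1 - lam)` and radius `r`. -/
def exteriorDomain (lam r : ℝ) : Set ℂ :=
  {z : ℂ | r < ‖z - 1 / (1 - (lam : ℂ))‖}

/-- The admissible perturbations: functions analytic on the exterior domain, symmetric with
respect to the real axis, with `z f'(z) → 0` and `f(z) → 0` as `z → ∞`. -/
structure IsAdmissible (lam r : ℝ) (f : ℂ → ℂ) : Prop where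
  analytic : AnalyticOnNhd ℂ f (exteriorDomain lam r)
  symmetric : ∀ z ∈ exteriorDomain lam r,
    f ((starRingEnd ℂ) z) = (starRingEnd ℂ) (f z)
  tendsto_mul_deriv : Tendsto (fun z : ℂ => z * deriv f z) (Bornology.cobounded ℂ) (𝓝 0)
  tendsto_zero : Tendsto f (Bornology.cobounded ℂ) (𝓝 0)

/-!
Write `K(z) = 1 / z + lam / (1 - z) + f(z)`.  The exterior of the circle with centre
`1 / (1 - lam)` and radius `√lam / (1 - lam)` is the image of the unit disc under
`z = 1 / (1 - lam) + √lam / ((1 - lam) v)`, and for `f = 0` one has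
`1 / K = β (v ^ 2 + a v + 1) / v` with `a = (1 + lam) / √lam`, `β = √lam / (1 - lam) ^ 2`: an affine
function of the Joukowski map `v + 1 / v`.  A small admissible `f` extends to a disc in `v` of
radius greater than `1`, vanishing at its centre (`IsAdmissible.exists_eq_mul`), so in general
`1 / K = β P(v) / v` with `P` analytic and uniformly close to `v ^ 2 + a v + 1`.

The perturbed map can again be brought to Joukowski form.  Near `v = 1` and near `v = -1` the function
`P(v) / v` has a real critical point (`exists_double_root_factor`); if `A + 2 B` and `A - 2 B` denote
the two critical values, the quadratic equation `P / v = A + B (η + 1 / η)` for `η` has a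
discriminant that is a perfect square, and it is solved by `η = v / S(v)` with `S` analytic and close
to `1` (`exists_joukowski_factor`).  This `η` is a small perturbation of the identity and has an
analytic inverse on a disc of radius greater than `1` (`exists_inverse_of_div_near_one`).

Thus `z` is a function `Z(η)` with `1 / K = β (A + B (η + 1 / η))`; it is analytic up to and across
the unit circle except for a simple pole at `0`, and its imaginary part is nonpositive on the
upper half of the circle, where `K` is real.  A Cauchy formula in `η` (`integral_im_mul_sin_div`)
writes such a function as the Cauchy transform, at the point `K`, of a positive measure: an atom at
`0`, coming from the pole, plus the density given by the boundary values of the imaginary part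
(`exists_measure_cauchyTransform_joukowski`).  Hence `G_μ(K(z)) = z` near `0`, and the behaviour as
`z → 0` forces `μ` to have mass `1` (`isProbabilityMeasure_of_cauchyTransform`).  All bounds depend
only on `lam`, `r` and the supremum of `|f|`, which gives the uniform `ε`; the statement on
sequences follows from it.
-/

open Metric ComplexConjugate

/-! ### Conjugation-equivariant functions -/

/-- `f` commutes with complex conjugation on the disc of radius `R` about `0`, which
for analytic `f` means that `f` is real on the real axis. -/
def ConjEquivariantOn (f : ℂ → ℂ) (R : ℝ) : Prop :=
  ∀ z ∈ ball (0 : ℂ) R, f (conj z) = conj (f z)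

lemma conj_mem_ball {z : ℂ} {R : ℝ} (hz : z ∈ ball (0 : ℂ) R) : conj z ∈ ball (0 : ℂ) R := by
  simpa using hz

lemma ConjEquivariantOn.mono {f : ℂ → ℂ} {R R' : ℝ} (h : ConjEquivariantOn f R) (hR : R' ≤ R) :
    ConjEquivariantOn f R' :=
  fun z hz => h z (ball_subset_ball hR hz)

lemma ConjEquivariantOn.im_ofReal {f : ℂ → ℂ} {R : ℝ} (h : ConjEquivariantOn f R) {t : ℝ}
    (ht : (t : ℂ) ∈ ball (0 : ℂ) R) : (f t).im = 0 := by
  have := h t ht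
  rw [Complex.conj_ofReal] at this
  exact Complex.conj_eq_iff_im.1 this.symm

lemma ConjEquivariantOn.ofReal_re {f : ℂ → ℂ} {R : ℝ} (h : ConjEquivariantOn f R) {t : ℝ}
    (ht : (t : ℂ) ∈ ball (0 : ℂ) R) : (((f t).re : ℝ) : ℂ) = f t :=
  Complex.ext (by simp) (by simp [h.im_ofReal ht])

lemma ConjEquivariantOn.deriv {f : ℂ → ℂ} {R : ℝ} (h : ConjEquivariantOn f R) :
    ConjEquivariantOn (deriv f) R := by
  intro z hz
  have h1 : (conj ∘ f ∘ conj : ℂ → ℂ) =ᶠ[𝓝 (conj z)] f := by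
    filter_upwards [isOpen_ball.mem_nhds (conj_mem_ball hz)] with w hw
    simp [h w hw]
  have h2 := congrFun (deriv_conj_conj (f := f)) (conj z)
  rw [h1.deriv_eq] at h2
  simpa using h2

lemma ConjEquivariantOn.dslope {f : ℂ → ℂ} {R : ℝ} (h : ConjEquivariantOn f R) {c : ℝ}
    (hc : (c : ℂ) ∈ ball (0 : ℂ) R) : ConjEquivariantOn (dslope f (c : ℂ)) R := by
  intro z hz
  rcases eq_or_ne z c with rfl | hzc
  · simpa using h.deriv _ hc
  · have : conj z ≠ (c : ℂ) := by
      intro hh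
      apply hzc
      rw [← Complex.conj_conj z, hh, Complex.conj_ofReal]
    have hcc := h _ hc
    rw [Complex.conj_ofReal] at hcc
    rw [dslope_of_ne _ this, dslope_of_ne _ hzc]
    simp [slope, h z hz, ← hcc]

/-! ### Double roots of perturbed quadratic polynomials -/

/-- A function close to `v ^ 2 + a * v + 1` is, up to a multiple of `v`, divisible by the square
of a linear factor `v - c` with `c` close to `1`: here `c` is a real critical point of `P v / v`,
found as a local minimum, and `κ` is the corresponding critical value. -/
theorem exists_double_root_factor {R R' : ℝ} (hR' : 1 < R') (hRR : R' < R) (hR2 : R' ≤ 2)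
    (a : ℝ) {δ : ℝ} (hδ : 0 < δ) : ∃ ε > 0, ∀ P : ℂ → ℂ, DifferentiableOn ℂ P (ball 0 R) →
      ConjEquivariantOn P R → (∀ v ∈ ball (0 : ℂ) R, ‖P v - (v ^ 2 + a * v + 1)‖ ≤ ε) →
      ∃ (c κ : ℝ) (g : ℂ → ℂ), |c - 1| ≤ δ ∧ |κ - (a + 2)| ≤ δ ∧
        DifferentiableOn ℂ g (ball 0 R') ∧ ConjEquivariantOn g R' ∧
        (∀ v ∈ ball (0 : ℂ) R', ‖g v - 1‖ ≤ δ) ∧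
        ∀ v ∈ ball (0 : ℂ) R', P v - κ * v = (v - c) ^ 2 * g v := by
  obtain ⟨d, hd0, hd1, hdδ, hdR⟩ : ∃ d > 0, d ≤ δ ∧ d ≤ (R' - 1) / 2 ∧
      12 * d ≤ δ * ((R' - 1) / 2) ^ 2 := by
    have : 0 < (R' - 1) / 2 := by linarith
    refine ⟨min δ (min ((R' - 1) / 2) (δ * ((R' - 1) / 2) ^ 2 / 12)), by positivity,
      min_le_left _ _, (min_le_right _ _).trans (min_le_left _ _), ?_⟩
    have := (min_le_right δ _).trans (min_le_right ((R' - 1) / 2) (δ * ((R' - 1) / 2) ^ 2 / 12))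
    linarith
  have hd2 : d ≤ 1 / 2 := by linarith
  refine ⟨d ^ 2 / 8, by positivity, fun P hP hsymm hclose => ?_⟩
  set ε := d ^ 2 / 8 with hε
  have hεd : ε ≤ d / 16 := by rw [hε]; nlinarith
  have hball : ∀ t : ℝ, t ∈ Set.Icc (1 - d) (1 + d) → (t : ℂ) ∈ ball (0 : ℂ) R := by
    intro t ht
    have h0 : 0 < t := by linarith [ht.1]
    rw [mem_ball_zero_iff, Complex.norm_real, Real.norm_of_nonneg h0.le]
    linarith [ht.2]
  -- The error of `P` on the real axis.
  have hre : ∀ t : ℝ, t ∈ Set.Icc (1 - d) (1 + d) → |(P t).re - (t ^ 2 + a * t + 1)| ≤ ε := by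
    intro t ht
    have h1 := (Complex.abs_re_le_norm _).trans (hclose t (hball t ht))
    have h2 : ((t : ℂ) ^ 2 + a * t + 1) = ((t ^ 2 + a * t + 1 : ℝ) : ℂ) := by push_cast; ring
    rwa [h2, Complex.sub_re, Complex.ofReal_re] at h1
  have hdiff : ∀ t : ℝ, t ∈ Set.Icc (1 - d) (1 + d) →
      HasDerivAt (fun x : ℝ => (P x).re / x)
        (((deriv P t).re * t - (P t).re * 1) / t ^ 2) t := by
    intro t ht
    have h0 : t ≠ 0 := by linarith [ht.1]
    exact ((hP.differentiableAt (isOpen_ball.mem_nhds (hball t ht))).hasDerivAt.real_of_complex).div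
      (hasDerivAt_id t) h0
  have hcont : ContinuousOn (fun x : ℝ => (P x).re / x) (Set.Icc (1 - d) (1 + d)) :=
    fun t ht => (hdiff t ht).continuousAt.continuousWithinAt
  have h1mem : (1 : ℝ) ∈ Set.Icc (1 - d) (1 + d) := ⟨by linarith, by linarith⟩
  obtain ⟨c, hc, hmin⟩ := isCompact_Icc.exists_isMinOn ⟨1, h1mem⟩ hcont
  have hc0 : 0 < c := by linarith [hc.1]
  have hmin1 : (P c).re / c ≤ a + 2 + ε := by
    have h1 : (P c).re / c ≤ (P (1 : ℝ)).re / (1 : ℝ) := hmin h1mem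
    have h2 := (abs_le.1 (hre 1 h1mem)).2
    rw [div_one] at h1
    linarith
  have hPc : (P c).re ≤ (a + 2 + ε) * c := by rwa [div_le_iff₀ hc0] at hmin1
  have hPc' := (abs_le.1 (hre c hc)).1
  -- As `t + 1 / t - 2 = (t - 1) ^ 2 / t`, the minimum lies within `√(3 ε) < d` of `1`, hence in
  -- the interior of the interval.
  have hsq : (c - 1) ^ 2 ≤ 3 * ε := by nlinarith [hc.2]
  have hcI : c ∈ Set.Ioo (1 - d) (1 + d) := by
    have h3 : |c - 1| < d := by
      apply abs_lt_of_sq_lt_sq _ hd0.le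
      rw [hε] at hsq
      nlinarith
    rw [abs_lt] at h3
    exact ⟨by linarith, by linarith⟩
  have hder := (hmin.isLocalMin (Icc_mem_nhds hcI.1 hcI.2)).hasDerivAt_eq_zero (hdiff c hc)
  have hder' : (deriv P c).re * c = (P c).re := by
    rw [div_eq_zero_iff] at hder
    rcases hder with h | h
    · linarith
    · exact absurd h (by positivity)
  have hcb := hball c hc
  set κ := (P c).re / c with hκ
  have hκc : κ * c = (P c).re := by rw [hκ]; field_simp
  have hκ1 : |κ - (a + 2)| ≤ 2 * ε := by
    rw [abs_le]
    refine ⟨?_, by linarith [hε ▸ (by positivity : 0 ≤ d ^ 2 / 8)]⟩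
    have : (a + 2 - 2 * ε) * c ≤ κ * c := by
      rw [hκc]
      nlinarith [sq_nonneg (c - 1), hc.1]
    linarith [le_of_mul_le_mul_right this hc0]
  set L : ℂ → ℂ := fun v => P v - κ * v with hL
  have hLd : DifferentiableOn ℂ L (ball 0 R) := by
    apply hP.sub
    fun_prop
  have hLs : ConjEquivariantOn L R := fun z hz => by simp [hL, hsymm z hz]
  have hLc : L c = 0 := by
    simp only [hL]
    rw [← hsymm.ofReal_re hcb, ← hκc]
    push_cast
    ring
  have hLc' : deriv L c = 0 := by
    have hPd := hP.differentiableAt (isOpen_ball.mem_nhds hcb)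
    have h1 : HasDerivAt L (deriv P c - κ * 1) c :=
      hPd.hasDerivAt.sub ((hasDerivAt_id (c : ℂ)).const_mul (κ : ℂ))
    rw [h1.deriv, ← hsymm.deriv.ofReal_re hcb]
    have : (deriv P c).re = κ := by
      have := hder'.trans hκc.symm
      exact mul_right_cancel₀ hc0.ne' this
    rw [this]; ring
  have hnhds : ball (0 : ℂ) R ∈ 𝓝 (c : ℂ) := isOpen_ball.mem_nhds hcb
  set g : ℂ → ℂ := dslope (dslope L c) c with hg
  have hgd : DifferentiableOn ℂ g (ball 0 R) :=
    (Complex.differentiableOn_dslope hnhds).2 ((Complex.differentiableOn_dslope hnhds).2 hLd)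
  have hgs : ConjEquivariantOn g R := (hLs.dslope hcb).dslope hcb
  have hgeq : ∀ v, L v = (v - c) ^ 2 * g v := by
    intro v
    have h1 := sub_smul_dslope L (c : ℂ) v
    have h2 := sub_smul_dslope (dslope L (c : ℂ)) (c : ℂ) v
    rw [dslope_same, hLc', sub_zero] at h2
    rw [hLc, sub_zero, ← h2] at h1
    rw [← h1]
    simp only [smul_eq_mul]
    ring
  have hsub : ball (0 : ℂ) R' ⊆ ball 0 R := ball_subset_ball hRR.le
  have hclosure : closedBall (0 : ℂ) R' ⊆ ball 0 R := closedBall_subset_ball hRR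
  refine ⟨c, κ, g, ?_, ?_, hgd.mono hsub, hgs.mono hRR.le, ?_, fun v _ => hgeq v⟩
  · rw [abs_le]; constructor <;> linarith [hc.1, hc.2]
  · linarith
  · intro v hv
    have hR0 : R' ≠ 0 := by linarith
    have hdc : DiffContOnCl ℂ (fun v => g v - 1) (ball 0 R') := by
      apply DifferentiableOn.diffContOnCl
      rw [closure_ball _ hR0]
      exact (hgd.mono hclosure).sub_const 1
    refine Complex.norm_le_of_forall_mem_frontier_norm_le isBounded_ball hdc ?_ (subset_closure hv)
    intro w hw
    rw [frontier_ball _ hR0, mem_sphere_zero_iff_norm] at hw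
    have hwR : w ∈ ball (0 : ℂ) R := by rw [mem_ball_zero_iff, hw]; exact hRR
    have hwc : (R' - 1) / 2 ≤ ‖w - c‖ := by
      have h1 := norm_sub_norm_le w (c : ℂ)
      rw [hw, Complex.norm_real, Real.norm_of_nonneg hc0.le] at h1
      linarith [hc.2]
    have hwc0 : 0 < ‖w - c‖ := by linarith
    have hne : w - c ≠ 0 := norm_pos_iff.1 hwc0
    have hkey : (g w - 1) * (w - c) ^ 2 = (P w - (w ^ 2 + a * w + 1))
        + (-((κ - (a + 2) : ℝ) : ℂ)) * w + (2 * (c - 1 : ℝ) : ℂ) * w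
        + (-((c - 1) * (c + 1) : ℝ) : ℂ) := by
      have := hgeq w
      simp only [hL] at this
      push_cast
      linear_combination -this
    have hc1 : |c - 1| ≤ d := by rw [abs_le]; constructor <;> linarith [hc.1, hc.2]
    have hbound : ‖(g w - 1) * (w - c) ^ 2‖ ≤ 12 * d := by
      rw [hkey]
      have e1 := hclose w hwR
      have e2 : ‖(-((κ - (a + 2) : ℝ) : ℂ)) * w‖ ≤ 4 * ε := by
        rw [norm_mul, norm_neg, Complex.norm_real, Real.norm_eq_abs, hw]
        nlinarith [abs_nonneg (κ - (a + 2))]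
      have e3 : ‖(2 * (c - 1 : ℝ) : ℂ) * w‖ ≤ 4 * d := by
        rw [norm_mul, norm_mul, Complex.norm_real, Real.norm_eq_abs, hw, Complex.norm_two]
        nlinarith [abs_nonneg (c - 1)]
      have e4 : ‖(-((c - 1) * (c + 1) : ℝ) : ℂ)‖ ≤ 3 * d := by
        rw [norm_neg, Complex.norm_real, Real.norm_eq_abs, abs_mul,
          abs_of_pos (by linarith : 0 < c + 1)]
        nlinarith [abs_nonneg (c - 1), hc.2]
      refine (norm_add₄_le).trans ?_
      linarith
    rw [norm_mul, norm_pow] at hbound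
    have h5 : ‖g w - 1‖ * ((R' - 1) / 2) ^ 2 ≤ δ * ((R' - 1) / 2) ^ 2 := by
      refine le_trans ?_ (hbound.trans hdR)
      gcongr
    exact le_of_mul_le_mul_right h5 (by nlinarith)

/-! ### Reduction to Joukowski form -/

/-- An analytic square root near `1`, commuting with conjugation. -/
lemma exists_sqrt_near_one : ∃ s : ℂ → ℂ, ∀ w : ℂ, ‖w - 1‖ < 1 →
    DifferentiableAt ℂ s w ∧ s w ^ 2 = w ∧ ‖s w - 1‖ ≤ ‖w - 1‖ ∧ s (conj w) = conj (s w) := by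
  refine ⟨fun w => Complex.exp (Complex.log w / 2), fun w hw => ?_⟩
  have hre : 0 < w.re := by
    have h1 := (Complex.abs_re_le_norm (w - 1)).trans_lt hw
    rw [Complex.sub_re, Complex.one_re, abs_lt] at h1
    linarith
  have hslit : w ∈ Complex.slitPlane := Or.inl hre
  have hw0 : w ≠ 0 := Complex.slitPlane_ne_zero hslit
  have hsq : Complex.exp (Complex.log w / 2) ^ 2 = w := by
    rw [← Complex.exp_nat_mul, Nat.cast_ofNat, mul_div_cancel₀ _ two_ne_zero, Complex.exp_log hw0]
  have hsre : 0 ≤ (Complex.exp (Complex.log w / 2)).re := by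
    rw [Complex.exp_re]
    refine mul_nonneg (Real.exp_pos _).le (Real.cos_nonneg_of_neg_pi_div_two_le_of_le ?_ ?_)
    · have := Complex.neg_pi_lt_log_im w
      simp
      linarith
    · have := Complex.log_im_le_pi w
      simp
      linarith
  refine ⟨?_, hsq, ?_, ?_⟩
  · exact ((Complex.differentiableAt_log hslit).div_const 2).cexp
  · set s := Complex.exp (Complex.log w / 2) with hs
    have h1 : w - 1 = (s - 1) * (s + 1) := by rw [← hsq]; ring
    have h2 : 1 ≤ ‖s + 1‖ := by
      have := (Complex.abs_re_le_norm (s + 1))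
      rw [Complex.add_re, Complex.one_re, abs_of_nonneg (by linarith)] at this
      linarith
    rw [h1, norm_mul]
    exact le_mul_of_one_le_right (norm_nonneg _) h2
  · have harg : w.arg ≠ Real.pi := (Complex.mem_slitPlane_iff_arg.1 hslit).1
    have h2 : conj (2 : ℂ) = 2 := Complex.conj_ofNat 2
    change Complex.exp (Complex.log (conj w) / 2) = conj (Complex.exp (Complex.log w / 2))
    rw [Complex.log_conj _ harg, ← Complex.exp_conj, map_div₀, h2]

/-- A function `P` close to `v ^ 2 + a * v + 1` satisfies `P / v = A + B (η + 1 / η)` for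
`η = v / S`, with real `A`, `B` close to `a`, `1` and an analytic `S` close to `1`.  With `κ₊`,
`κ₋` the critical values of `P / v` near `±1`, and `A ± 2 B = κ±`, the discriminant
`(P - A v) ^ 2 - (2 B v) ^ 2 = (P - κ₊ v) (P - κ₋ v)` of the quadratic equation for `S` is a
perfect square. -/
theorem exists_joukowski_factor {R R' : ℝ} (hR' : 1 < R') (hRR : R' < R) (hR2 : R' ≤ 2)
    (a : ℝ) {δ : ℝ} (hδ : 0 < δ) : ∃ ε > 0, ∀ P : ℂ → ℂ, DifferentiableOn ℂ P (ball 0 R) →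
      ConjEquivariantOn P R → (∀ v ∈ ball (0 : ℂ) R, ‖P v - (v ^ 2 + a * v + 1)‖ ≤ ε) →
      ∃ (A B : ℝ) (S : ℂ → ℂ), |A - a| ≤ δ ∧ |B - 1| ≤ δ ∧
        DifferentiableOn ℂ S (ball 0 R') ∧ ConjEquivariantOn S R' ∧
        (∀ v ∈ ball (0 : ℂ) R', ‖S v - 1‖ ≤ δ) ∧
        ∀ v ∈ ball (0 : ℂ) R', P v * S v = A * v * S v + B * (S v ^ 2 + v ^ 2) := by
  obtain ⟨d, hd0, hdδ, hd6⟩ : ∃ d > 0, 33 * d ≤ δ ∧ d ≤ 1 / 6 :=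
    ⟨min (δ / 33) (1 / 6), by positivity, by linarith [min_le_left (δ / 33) (1 / 6)],
      min_le_right _ _⟩
  obtain ⟨ε₁, hε₁, H₁⟩ := exists_double_root_factor hR' hRR hR2 a hd0
  obtain ⟨ε₂, hε₂, H₂⟩ := exists_double_root_factor hR' hRR hR2 (-a) hd0
  refine ⟨min d (min ε₁ ε₂), by positivity, fun P hP hsymm hclose => ?_⟩
  have hneg : ∀ {r : ℝ} {v : ℂ}, v ∈ ball (0 : ℂ) r → -v ∈ ball (0 : ℂ) r := by
    intro r v hv
    simpa using hv
  have hsub : ball (0 : ℂ) R' ⊆ ball 0 R := ball_subset_ball hRR.le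
  obtain ⟨c₁, κ₁, g₁, hc₁, hκ₁, hgd₁, hgs₁, hg₁, hP₁⟩ := H₁ P hP hsymm fun v hv =>
    (hclose v hv).trans ((min_le_right _ _).trans (min_le_left _ _))
  obtain ⟨c₂, κ₂, g₂, hc₂, hκ₂, hgd₂, hgs₂, hg₂, hP₂⟩ := H₂ (fun v => P (-v))
    (hP.comp differentiable_neg.differentiableOn fun v hv => hneg hv)
    (fun v hv => by
      have := hsymm (-v) (hneg hv)
      rwa [map_neg] at this)
    (fun v hv => by
      have := (hclose (-v) (hneg hv)).trans ((min_le_right _ _).trans (min_le_right _ _))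
      refine le_trans (le_of_eq ?_) this
      congr 1
      push_cast
      ring)
  obtain ⟨s, hs⟩ := exists_sqrt_near_one
  set h : ℂ → ℂ := fun v => g₁ v * g₂ (-v) with hh
  have hh1 : ∀ v ∈ ball (0 : ℂ) R', ‖h v - 1‖ ≤ 3 * d := by
    intro v hv
    have e1 := hg₁ v hv
    have e2 := hg₂ (-v) (hneg hv)
    have e3 : h v - 1 = (g₁ v - 1) * (g₂ (-v) - 1) + (g₁ v - 1) + (g₂ (-v) - 1) := by
      simp only [hh]; ring
    rw [e3]
    refine norm_add₃_le.trans ?_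
    rw [norm_mul]
    nlinarith [norm_nonneg (g₁ v - 1), norm_nonneg (g₂ (-v) - 1)]
  have hh2 : ∀ v ∈ ball (0 : ℂ) R', ‖h v - 1‖ < 1 := fun v hv => by linarith [hh1 v hv]
  have hhd : DifferentiableOn ℂ h (ball 0 R') :=
    hgd₁.mul (hgd₂.comp differentiable_neg.differentiableOn fun v hv => hneg hv)
  have hhs : ConjEquivariantOn h R' := fun v hv => by
    have := hgs₂ (-v) (hneg hv)
    rw [map_neg] at this
    simp [hh, hgs₁ v hv, this]
  obtain ⟨A, hA⟩ : ∃ A : ℝ, A = (κ₁ - κ₂) / 2 := ⟨_, rfl⟩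
  obtain ⟨B, hB⟩ : ∃ B : ℝ, B = (κ₁ + κ₂) / 4 := ⟨_, rfl⟩
  rw [abs_le] at hκ₁ hκ₂
  have hAa : |A - a| ≤ d := by rw [abs_le]; constructor <;> linarith
  have hB1 : |B - 1| ≤ d / 2 := by rw [abs_le]; constructor <;> linarith
  have hBpos : 1 / 2 ≤ B := by have := (abs_le.1 hB1).1; linarith
  have hB0 : (B : ℂ) ≠ 0 := by
    have : B ≠ 0 := by linarith
    exact_mod_cast this
  refine ⟨A, B, fun v => (P v - A * v - (v - c₁) * (v + c₂) * s (h v)) / (2 * B), by linarith,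
    by linarith, ?_, ?_, ?_, ?_⟩
  · refine DifferentiableOn.div_const (DifferentiableOn.sub ((hP.mono hsub).sub (by fun_prop))
      (DifferentiableOn.mul (by fun_prop) ?_)) _
    exact fun v hv => (hs _ (hh2 v hv)).1.comp_differentiableWithinAt v (hhd v hv)
  · intro v hv
    have h2 : conj (2 : ℂ) = 2 := Complex.conj_ofNat 2
    simp [hsymm v (hsub hv), hhs v hv, (hs _ (hh2 v hv)).2.2.2, h2]
  · intro v hv
    have hsv := (hs _ (hh2 v hv)).2.2.1.trans (hh1 v hv)
    have hPv := (hclose v (hsub hv)).trans (min_le_left _ _)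
    have hv2 : ‖v‖ ≤ 2 := (mem_ball_zero_iff.1 hv).le.trans hR2
    set σ := s (h v)
    have hσ : ‖σ‖ ≤ 2 := by
      have := norm_add_le (σ - 1) 1
      rw [sub_add_cancel, norm_one] at this
      linarith
    have hkey : (P v - A * v - (v - c₁) * (v + c₂) * σ) / (2 * B) - 1 =
        ((P v - (v ^ 2 + a * v + 1)) + (-((A - a : ℝ) : ℂ) * v) +
          ((v ^ 2 - 1) * (-(σ - 1))) + (σ * ((c₁ - 1 : ℝ) * (v + 1) +
            (-((c₂ - 1 : ℝ) : ℂ) * (v - 1)) + ((c₁ - 1 : ℝ) * (c₂ - 1 : ℝ)))) +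
          (-(2 * (B - 1 : ℝ) : ℂ))) / (2 * B) := by
      field_simp
      push_cast
      ring
    have e2 : ‖-((A - a : ℝ) : ℂ) * v‖ ≤ 2 * d := by
      rw [norm_mul, norm_neg, Complex.norm_real, Real.norm_eq_abs]
      nlinarith [abs_nonneg (A - a), norm_nonneg v]
    have e3 : ‖(v ^ 2 - 1) * (-(σ - 1))‖ ≤ 15 * d := by
      rw [norm_mul, norm_neg]
      have : ‖v ^ 2 - 1‖ ≤ 5 := by
        refine (norm_sub_le _ _).trans ?_
        rw [norm_pow, norm_one]
        nlinarith [norm_nonneg v]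
      nlinarith [norm_nonneg (σ - 1), norm_nonneg (v ^ 2 - 1)]
    have e4 : ‖σ * ((c₁ - 1 : ℝ) * (v + 1) + (-((c₂ - 1 : ℝ) : ℂ) * (v - 1)) +
        ((c₁ - 1 : ℝ) * (c₂ - 1 : ℝ)))‖ ≤ 14 * d := by
      have f1 : ‖((c₁ - 1 : ℝ) : ℂ) * (v + 1)‖ ≤ 3 * d := by
        rw [norm_mul, Complex.norm_real, Real.norm_eq_abs]
        have := norm_add_le v 1
        rw [norm_one] at this
        nlinarith [abs_nonneg (c₁ - 1), norm_nonneg (v + 1)]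
      have f2 : ‖-((c₂ - 1 : ℝ) : ℂ) * (v - 1)‖ ≤ 3 * d := by
        rw [norm_mul, norm_neg, Complex.norm_real, Real.norm_eq_abs]
        have := norm_sub_le v 1
        rw [norm_one] at this
        nlinarith [abs_nonneg (c₂ - 1), norm_nonneg (v - 1)]
      have f3 : ‖((c₁ - 1 : ℝ) : ℂ) * ((c₂ - 1 : ℝ) : ℂ)‖ ≤ d := by
        rw [norm_mul, Complex.norm_real, Complex.norm_real, Real.norm_eq_abs, Real.norm_eq_abs]
        nlinarith [abs_nonneg (c₁ - 1), abs_nonneg (c₂ - 1)]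
      rw [norm_mul]
      have f4 := (norm_add₃_le (a := ((c₁ - 1 : ℝ) : ℂ) * (v + 1))
        (b := -((c₂ - 1 : ℝ) : ℂ) * (v - 1)) (c := ((c₁ - 1 : ℝ) : ℂ) * ((c₂ - 1 : ℝ) : ℂ)))
      calc _ ≤ 2 * (7 * d) := by gcongr; linarith
        _ = 14 * d := by ring
    have e5 : ‖-(2 * (B - 1 : ℝ) : ℂ)‖ ≤ d := by
      rw [norm_neg, norm_mul, Complex.norm_two, Complex.norm_real, Real.norm_eq_abs]
      linarith
    have hden : 1 ≤ ‖(2 * B : ℂ)‖ := by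
      rw [norm_mul, Complex.norm_two, Complex.norm_real, Real.norm_eq_abs,
        abs_of_pos (by linarith)]
      linarith
    rw [hkey, norm_div]
    refine (div_le_self (norm_nonneg _) hden).trans ?_
    refine (norm_add_le _ _).trans ?_
    have := norm_add₄_le (a := P v - (v ^ 2 + a * v + 1)) (b := -((A - a : ℝ) : ℂ) * v)
      (c := (v ^ 2 - 1) * (-(σ - 1))) (d := σ * ((c₁ - 1 : ℝ) * (v + 1) +
        (-((c₂ - 1 : ℝ) : ℂ) * (v - 1)) + ((c₁ - 1 : ℝ) * (c₂ - 1 : ℝ))))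
    linarith
  · intro v hv
    have hq₁ := hP₁ v hv
    have hq₂ := hP₂ (-v) (hneg hv)
    rw [neg_neg] at hq₂
    have hσ := (hs _ (hh2 v hv)).2.1
    simp only [hh] at hσ
    simp only [hh]
    set σ := s (g₁ v * g₂ (-v))
    have hdisc : (P v - A * v) ^ 2 - ((v - c₁) * (v + c₂) * σ) ^ 2 = 4 * B ^ 2 * v ^ 2 := by
      have hA' : (A : ℂ) = (κ₁ - κ₂) / 2 := by rw [hA]; push_cast; ring
      have hB' : (B : ℂ) = (κ₁ + κ₂) / 4 := by rw [hB]; push_cast; ring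
      have : ((v - c₁) * (v + c₂) * σ) ^ 2 = (P v - κ₁ * v) * (P v - κ₂ * -v) := by
        rw [hq₁, hq₂, mul_pow, hσ]
        ring
      rw [this, hA', hB']
      ring
    field_simp
    linear_combination hdisc

/-! ### Inverting a small perturbation of the identity -/

/-- The map `v ↦ v / S v`, with `S` close to `1`, has an analytic inverse `Φ` on a disc of radius
greater than `1`, because it is a small Lipschitz perturbation of the identity; for the same
reason `Φ` maps real points to real points and the upper half of the disc into the closed upper
half-plane. -/
theorem exists_inverse_of_div_near_one {R : ℝ} (hR : 1 < R) : ∃ R₁ > 1, ∃ δ > 0, ∀ S : ℂ → ℂ,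
    DifferentiableOn ℂ S (ball 0 R) → ConjEquivariantOn S R →
    (∀ v ∈ ball (0 : ℂ) R, ‖S v - 1‖ ≤ δ) →
    ∃ Φ : ℂ → ℂ, DifferentiableOn ℂ Φ (ball 0 R₁) ∧ ConjEquivariantOn Φ R₁ ∧
      (∀ y ∈ ball (0 : ℂ) R₁, Φ y ∈ ball (0 : ℂ) R ∧ Φ y = y * S (Φ y)) ∧
      (∀ y ∈ ball (0 : ℂ) R₁, 0 ≤ y.im → 0 ≤ (Φ y).im) ∧
      ∀ v : ℂ, ‖v‖ ≤ 1 → ‖v / S v‖ ≤ 1 → Φ (v / S v) = v := by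
  -- The derivative of `v / S v` differs from `1` by at most `k` on the disc of radius `r`, and
  -- `k` is chosen such that the image of that disc contains the disc of radius `(1 - k) r > 1`.
  obtain ⟨r, hr1, hrR⟩ := exists_between hR
  obtain ⟨r', hr'1, hr'r⟩ := exists_between hr1
  obtain ⟨k, hk0, hk2, hkr⟩ : ∃ k : ℝ, 0 < k ∧ k ≤ 1 / 2 ∧ 1 < (1 - k) * r' := by
    refine ⟨min (1 / 2) ((r' - 1) / (2 * r')), ?_, min_le_left _ _, ?_⟩
    · have : 0 < (r' - 1) / (2 * r') := by apply div_pos <;> linarith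
      positivity
    · have h1 : min (1 / 2) ((r' - 1) / (2 * r')) ≤ (r' - 1) / (2 * r') := min_le_right _ _
      have h2 : (r' - 1) / (2 * r') * r' = (r' - 1) / 2 := by field_simp
      nlinarith
  have hRr : 0 < (R - r) / 2 := by linarith
  obtain ⟨δ, hδ0, hδ2, hδk⟩ : ∃ δ : ℝ, 0 < δ ∧ δ ≤ 1 / 2 ∧ R * (2 * δ) / ((R - r) / 2) ≤ k := by
    refine ⟨min (1 / 2) (k * ((R - r) / 2) / (2 * R)), by positivity, min_le_left _ _, ?_⟩
    have h1 := min_le_right (1 / 2) (k * ((R - r) / 2) / (2 * R))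
    rw [le_div_iff₀ (by linarith)] at h1
    rw [div_le_iff₀ hRr]
    linarith
  refine ⟨(1 - k) * r', hkr, δ, hδ0, fun S hS hsymm hclose => ?_⟩
  have hSne : ∀ v ∈ ball (0 : ℂ) R, 1 / 2 ≤ ‖S v‖ := by
    intro v hv
    have h1 := norm_sub_norm_le (1 : ℂ) (1 - S v)
    rw [sub_sub_cancel, norm_one, norm_sub_rev] at h1
    linarith [hclose v hv]
  have hS0 : ∀ v ∈ ball (0 : ℂ) R, S v ≠ 0 := fun v hv => by
    have := hSne v hv
    exact norm_pos_iff.1 (by linarith)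
  set E : ℂ → ℂ := fun v => v / S v with hE
  have hEd : DifferentiableOn ℂ E (ball 0 R) := differentiableOn_id.div hS hS0
  have hEs : ConjEquivariantOn E R := fun v hv => by simp [hE, hsymm v hv]
  have hEclose : ∀ v ∈ ball (0 : ℂ) R, ‖E v - v‖ ≤ R * (2 * δ) := by
    intro v hv
    have hne := hS0 v hv
    have : E v - v = -(v * ((S v - 1) / S v)) := by
      simp only [hE]
      field_simp
      ring
    rw [this, norm_neg, norm_mul, norm_div]
    have h1 : ‖S v - 1‖ / ‖S v‖ ≤ 2 * δ := by
      rw [div_le_iff₀ (by linarith [hSne v hv])]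
      nlinarith [hSne v hv, hclose v hv]
    exact mul_le_mul (mem_ball_zero_iff.1 hv).le h1 (by positivity) (by linarith)
  have hrsub : ball (0 : ℂ) r ⊆ ball 0 R := ball_subset_ball hrR.le
  have hEat : ∀ v ∈ ball (0 : ℂ) R, DifferentiableAt ℂ E v := fun v hv =>
    hEd.differentiableAt (isOpen_ball.mem_nhds hv)
  have hder : ∀ v ∈ ball (0 : ℂ) r, ‖deriv (fun w => E w - w) v‖ ≤ k := by
    intro v hv
    have hcl : closedBall v ((R - r) / 2) ⊆ ball 0 R := by
      intro w hw
      have h1 := norm_add_le v (w - v)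
      rw [add_sub_cancel] at h1
      rw [mem_closedBall, dist_eq_norm] at hw
      rw [mem_ball_zero_iff] at hv ⊢
      linarith
    have hd : DiffContOnCl ℂ (fun w => E w - w) (ball v ((R - r) / 2)) := by
      apply DifferentiableOn.diffContOnCl
      rw [closure_ball _ hRr.ne']
      exact (hEd.mono hcl).sub differentiableOn_id
    refine (Complex.norm_deriv_le_of_forall_mem_sphere_norm_le hRr hd fun w hw => ?_).trans hδk
    exact hEclose w (hcl (sphere_subset_closedBall hw))
  have hlip : ∀ v ∈ ball (0 : ℂ) r, ∀ w ∈ ball (0 : ℂ) r,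
      ‖E v - E w - (v - w)‖ ≤ k * ‖v - w‖ := by
    intro v hv w hw
    have h1 := Convex.norm_image_sub_le_of_norm_deriv_le
      (fun x hx => (hEat x (hrsub hx)).sub differentiableAt_id) hder (convex_ball 0 r) hw hv
    refine le_trans (le_of_eq ?_) h1
    congr 1
    simp only [Pi.sub_apply, id]
    ring
  have hanti : ∀ v ∈ ball (0 : ℂ) r, ∀ w ∈ ball (0 : ℂ) r, ‖v - w‖ ≤ 2 * ‖E v - E w‖ := by
    intro v hv w hw
    have h1 := hlip v hv w hw
    have h2 := norm_sub_norm_le (v - w) (E v - E w)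
    rw [norm_sub_rev (v - w)] at h2
    nlinarith [norm_nonneg (v - w)]
  have hinj : Set.InjOn E (ball 0 r) := by
    intro v hv w hw hvw
    have := hanti v hv w hw
    rw [hvw, sub_self, norm_zero, mul_zero] at this
    exact sub_eq_zero.1 (norm_le_zero_iff.1 this)
  have happ : ApproximatesLinearOn E
      ((ContinuousLinearEquiv.refl ℂ ℂ : ℂ ≃L[ℂ] ℂ) : ℂ →L[ℂ] ℂ) (ball 0 r) ⟨k, hk0.le⟩ :=
    fun v hv w hw => hlip v hv w hw
  have hsurj : Set.SurjOn E (closedBall 0 r') (closedBall 0 ((1 - k) * r')) := by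
    have h1 := happ.surjOn_closedBall_of_nonlinearRightInverse
      (ContinuousLinearEquiv.refl ℂ ℂ).toNonlinearRightInverse (b := 0) (ε := r') (by linarith)
      (closedBall_subset_ball hr'r)
    have hE0 : E 0 = 0 := by simp [hE]
    have hnn : ((ContinuousLinearEquiv.refl ℂ ℂ).toNonlinearRightInverse).nnnorm = 1 := by
      change ‖(((ContinuousLinearEquiv.refl ℂ ℂ).symm : ℂ ≃L[ℂ] ℂ) : ℂ →L[ℂ] ℂ)‖₊ = 1
      simp
    rw [hE0, hnn] at h1
    rw [NNReal.coe_one, inv_one] at h1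
    exact h1
  have hex : ∀ y ∈ ball (0 : ℂ) ((1 - k) * r'), ∃ v ∈ ball (0 : ℂ) r, E v = y := fun y hy => by
    obtain ⟨v, hv, hvy⟩ := hsurj (ball_subset_closedBall hy)
    exact ⟨v, closedBall_subset_ball hr'r hv, hvy⟩
  choose! Φ hΦmem hΦ using hex
  have hΦE : ∀ v ∈ ball (0 : ℂ) r, E v ∈ ball (0 : ℂ) ((1 - k) * r') → Φ (E v) = v :=
    fun v hv hv' => hinj (hΦmem _ hv') hv (hΦ _ hv')
  have hΦcont : ∀ y ∈ ball (0 : ℂ) ((1 - k) * r'), ContinuousAt Φ y := by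
    intro y hy
    rw [ContinuousAt, tendsto_iff_norm_sub_tendsto_zero]
    have h0 : Tendsto (fun x => 2 * ‖x - y‖) (𝓝 y) (𝓝 0) := by
      have : ContinuousAt (fun x : ℂ => 2 * ‖x - y‖) y := by fun_prop
      simpa [ContinuousAt] using this
    refine squeeze_zero' (Eventually.of_forall fun _ => norm_nonneg _) ?_ h0
    filter_upwards [isOpen_ball.mem_nhds hy] with x hx
    have := hanti _ (hΦmem x hx) _ (hΦmem y hy)
    rwa [hΦ x hx, hΦ y hy] at this
  have hΦd : DifferentiableOn ℂ Φ (ball 0 ((1 - k) * r')) := by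
    intro y hy
    have hmem := hΦmem y hy
    have hE' := (hEat _ (hrsub hmem)).hasDerivAt
    have hne : deriv E (Φ y) ≠ 0 := by
      intro h0
      have h1 := hder _ hmem
      have h2 : HasDerivAt (fun w => E w - w) (deriv E (Φ y) - 1) (Φ y) :=
        hE'.sub (hasDerivAt_id (Φ y))
      rw [h2.deriv, h0] at h1
      norm_num at h1
      linarith
    refine (HasDerivAt.of_local_left_inverse (hΦcont y hy) hE' hne ?_).differentiableAt
      |>.differentiableWithinAt
    filter_upwards [isOpen_ball.mem_nhds hy] with x hx using hΦ x hx
  have hΦs : ConjEquivariantOn Φ ((1 - k) * r') := by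
    intro y hy
    refine hinj (hΦmem _ (conj_mem_ball hy)) (conj_mem_ball (hΦmem y hy)) ?_
    rw [hΦ _ (conj_mem_ball hy), hEs _ (hrsub (hΦmem y hy)), hΦ y hy]
  refine ⟨Φ, hΦd, hΦs, fun y hy => ⟨hrsub (hΦmem y hy), ?_⟩, ?_, ?_⟩
  · have h1 := hΦ y hy
    simp only [hE] at h1
    rwa [div_eq_iff (hS0 _ (hrsub (hΦmem y hy)))] at h1
  · intro y hy him
    -- Comparing `y` and its conjugate shows that `Im y` and `Im (Φ y)` have the same sign.
    have h1 := hlip _ (hΦmem y hy) _ (conj_mem_ball (hΦmem y hy))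
    rw [hEs _ (hrsub (hΦmem y hy)), hΦ y hy, Complex.sub_conj, Complex.sub_conj, ← sub_mul,
      norm_mul, norm_mul, Complex.norm_I, mul_one, mul_one, ← Complex.ofReal_sub,
      Complex.norm_real, Complex.norm_real, Real.norm_eq_abs, Real.norm_eq_abs] at h1
    by_contra! hneg
    rw [abs_of_neg (by linarith : 2 * (Φ y).im < 0)] at h1
    have h2 := le_abs_self (2 * y.im - 2 * (Φ y).im)
    nlinarith
  · intro v hv hEv
    refine hΦE v ?_ ?_
    · rw [mem_ball_zero_iff]; linarith
    · rw [mem_ball_zero_iff]; simp only [hE]; linarith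

/-! ### The measure in the Joukowski coordinate -/

lemma circleMap_zero_one_add_inv (θ : ℝ) :
    circleMap 0 1 θ + 1 / circleMap 0 1 θ = 2 * (Real.cos θ : ℂ) := by
  have h : circleMap 0 1 θ = Complex.exp (θ * Complex.I) := by simp [circleMap]
  rw [h, one_div, ← Complex.exp_neg, Complex.ofReal_cos, Complex.cos, ← neg_mul]
  ring

lemma circleMap_zero_one_eq (θ : ℝ) :
    circleMap 0 1 θ = (Real.cos θ : ℂ) + Real.sin θ * Complex.I := by
  simp [circleMap, Complex.exp_mul_I]

lemma circleMap_zero_one_ne_zero (θ : ℝ) : circleMap 0 1 θ ≠ 0 :=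
  circleMap_ne_center one_ne_zero

lemma norm_circleMap_zero_one (θ : ℝ) : ‖circleMap 0 1 θ‖ = 1 := by simp

/-- The Joukowski map `η ↦ η + 1 / η` sends the punctured unit disc off `[-2, 2]`. -/
lemma two_cos_sub_ne_zero {η : ℂ} (h0 : η ≠ 0) (h1 : ‖η‖ < 1) (θ : ℝ) :
    2 * (Real.cos θ : ℂ) - (η + 1 / η) ≠ 0 := by
  rw [← circleMap_zero_one_add_inv]
  have hζ := circleMap_zero_one_ne_zero θ
  have hn := norm_circleMap_zero_one θ
  set ζ := circleMap 0 1 θ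
  have e : ζ + 1 / ζ - (η + 1 / η) = (ζ - η) * (ζ * η - 1) / (ζ * η) := by
    field_simp
    ring
  rw [e]
  refine div_ne_zero (mul_ne_zero ?_ ?_) (mul_ne_zero hζ h0)
  · intro h
    rw [sub_eq_zero] at h
    rw [h] at hn
    linarith
  · intro h
    rw [sub_eq_zero] at h
    have := congrArg norm h
    rw [norm_mul, hn, one_mul, norm_one] at this
    linarith

/-- Schwarz-type formula in the Joukowski coordinate: an analytic function on the disc that is
real on the real axis and vanishes at `0` is recovered from the boundary values of its imaginary
part.  It is the Cauchy formula for `q(ζ) (ζ² - 1) η / (ζ (ζ η - 1))`, symmetrized under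
`ζ ↦ 1 / ζ`. -/
theorem integral_im_mul_sin_div {R : ℝ} (hR : 1 < R) {q : ℂ → ℂ}
    (hq : DifferentiableOn ℂ q (ball 0 R)) (hqs : ConjEquivariantOn q R) (hq0 : q 0 = 0)
    {η : ℂ} (h0 : η ≠ 0) (h1 : ‖η‖ < 1) :
    ∫ θ in (0 : ℝ)..2 * Real.pi, ((((q (circleMap 0 1 θ)).im * Real.sin θ : ℝ) : ℂ) /
      (2 * (Real.cos θ : ℂ) - (η + 1 / η))) = -Real.pi * q η := by
  have hball : ∀ θ : ℝ, circleMap 0 1 θ ∈ ball (0 : ℂ) R := fun θ => by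
    rw [mem_ball_zero_iff, norm_circleMap_zero_one]; exact hR
  have hqcont : Continuous fun θ : ℝ => q (circleMap 0 1 θ) :=
    hq.continuousOn.comp_continuous (continuous_circleMap 0 1) hball
  have hDcont : Continuous fun θ : ℝ => 2 * (Real.cos θ : ℂ) - (η + 1 / η) := by fun_prop
  have hD : ∀ θ : ℝ, 2 * (Real.cos θ : ℂ) - (η + 1 / η) ≠ 0 := two_cos_sub_ne_zero h0 h1
  have hcl : closedBall (0 : ℂ) 1 ⊆ ball 0 R := closedBall_subset_ball hR
  have hnear : ball (0 : ℂ) R ∈ 𝓝 (0 : ℂ) := ball_mem_nhds _ (by linarith)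
  have hden : ∀ ζ ∈ closedBall (0 : ℂ) 1, ζ * η - 1 ≠ 0 := by
    intro ζ hζ h
    rw [sub_eq_zero] at h
    have h2 := congrArg norm h
    rw [norm_mul, norm_one] at h2
    rw [mem_closedBall_zero_iff] at hζ
    nlinarith [norm_nonneg η, norm_nonneg ζ]
  have hg : DiffContOnCl ℂ (fun ζ => dslope q 0 ζ * (ζ ^ 2 - 1) * η / (ζ * η - 1)) (ball 0 1) := by
    apply DifferentiableOn.diffContOnCl
    rw [closure_ball _ one_ne_zero]
    refine DifferentiableOn.div (DifferentiableOn.mul (DifferentiableOn.mul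
      (((Complex.differentiableOn_dslope hnear).2 hq).mono hcl) ?_) ?_) ?_ hden <;> fun_prop
  have hcauchy := hg.circleIntegral_sub_inv_smul (mem_ball_zero_iff.2 h1)
  have hη : dslope q 0 η * (η ^ 2 - 1) * η / (η * η - 1) = q η := by
    have h2 := sub_smul_dslope q 0 η
    rw [hq0, sub_zero, sub_zero, smul_eq_mul] at h2
    have h3 := hden η (mem_closedBall_zero_iff.2 h1.le)
    rw [← h2, div_eq_iff h3]
    ring
  rw [hη, circleIntegral] at hcauchy
  have hA : ∫ θ in (0 : ℝ)..2 * Real.pi, q (circleMap 0 1 θ) * Real.sin θ /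
      (2 * (Real.cos θ : ℂ) - (η + 1 / η)) = -(Real.pi * Complex.I) * q η := by
    have h2 : ∀ θ : ℝ, deriv (circleMap 0 1) θ • (circleMap 0 1 θ - η)⁻¹ •
        (dslope q 0 (circleMap 0 1 θ) * (circleMap 0 1 θ ^ 2 - 1) * η / (circleMap 0 1 θ * η - 1))
        = (-2) * (q (circleMap 0 1 θ) * Real.sin θ / (2 * (Real.cos θ : ℂ) - (η + 1 / η))) := by
      intro θ
      have hsin : (Real.sin θ : ℂ) = (circleMap 0 1 θ - 1 / circleMap 0 1 θ) / (2 * Complex.I) := by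
        have e1 := circleMap_zero_one_add_inv θ
        have e2 := circleMap_zero_one_eq θ
        have e3 : circleMap 0 1 θ - 1 / circleMap 0 1 θ = 2 * Real.sin θ * Complex.I := by
          linear_combination 2 * e2 - e1
        rw [e3]
        have := Complex.I_ne_zero
        field_simp
      have hD' := hD θ
      rw [deriv_circleMap, hsin]
      rw [← circleMap_zero_one_add_inv] at hD' ⊢
      have hs := sub_smul_dslope q 0 (circleMap 0 1 θ)
      rw [hq0, sub_zero, sub_zero, smul_eq_mul] at hs
      have hζ := circleMap_zero_one_ne_zero θ
      have hd1 := hden (circleMap 0 1 θ) (by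
        rw [mem_closedBall_zero_iff, norm_circleMap_zero_one])
      have hd2 : circleMap 0 1 θ - η ≠ 0 := by
        intro h
        rw [sub_eq_zero] at h
        rw [← h, norm_circleMap_zero_one] at h1
        exact lt_irrefl _ h1
      rw [← hs]
      simp only [smul_eq_mul]
      set ζ := circleMap 0 1 θ
      have hfac : ζ + 1 / ζ - (η + 1 / η) = (ζ - η) * (ζ * η - 1) / (ζ * η) := by
        field_simp
        ring
      rw [hfac]
      have hI := Complex.I_ne_zero
      field_simp
      rw [Complex.I_sq]
      ring
    simp_rw [h2] at hcauchy
    rw [intervalIntegral.integral_const_mul, smul_eq_mul] at hcauchy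
    linear_combination (-1 / 2) * hcauchy
  have hB : ∫ θ in (0 : ℝ)..2 * Real.pi, conj (q (circleMap 0 1 θ)) * Real.sin θ /
      (2 * (Real.cos θ : ℂ) - (η + 1 / η)) = (Real.pi * Complex.I) * q η := by
    have h2 := intervalIntegral.integral_comp_sub_left (a := 0) (b := 2 * Real.pi)
      (fun θ : ℝ => q (circleMap 0 1 θ) * Real.sin θ / (2 * (Real.cos θ : ℂ) - (η + 1 / η)))
      (2 * Real.pi)
    rw [sub_self, sub_zero, hA] at h2
    have h3 : ∀ θ : ℝ, circleMap 0 1 (2 * Real.pi - θ) = conj (circleMap 0 1 θ) := by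
      intro θ
      rw [circleMap_zero_one_eq, circleMap_zero_one_eq, Real.cos_two_pi_sub, Real.sin_two_pi_sub]
      simp [-Complex.ofReal_cos, -Complex.ofReal_sin]
    have h4 : ∀ θ : ℝ, q (circleMap 0 1 (2 * Real.pi - θ)) * Real.sin (2 * Real.pi - θ) /
        (2 * (Real.cos (2 * Real.pi - θ) : ℂ) - (η + 1 / η)) =
        -(conj (q (circleMap 0 1 θ)) * Real.sin θ / (2 * (Real.cos θ : ℂ) - (η + 1 / η))) := by
      intro θ
      rw [h3, hqs _ (hball θ), Real.cos_two_pi_sub, Real.sin_two_pi_sub]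
      push_cast
      ring
    simp_rw [h4] at h2
    rw [intervalIntegral.integral_neg] at h2
    linear_combination -h2
  have hC : ∀ θ : ℝ, (((q (circleMap 0 1 θ)).im * Real.sin θ : ℝ) : ℂ) /
      (2 * (Real.cos θ : ℂ) - (η + 1 / η)) = (-Complex.I / 2) *
      (q (circleMap 0 1 θ) * Real.sin θ / (2 * (Real.cos θ : ℂ) - (η + 1 / η)) -
        conj (q (circleMap 0 1 θ)) * Real.sin θ / (2 * (Real.cos θ : ℂ) - (η + 1 / η))) := by
    intro θ
    rw [← sub_div, ← sub_mul, Complex.sub_conj]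
    push_cast
    linear_combination (((q (circleMap 0 1 θ)).im : ℂ) * Complex.sin θ /
      (2 * Complex.cos θ - (η + 1 / η))) * Complex.I_sq
  simp_rw [hC]
  have hsinc : Continuous fun θ : ℝ => (Real.sin θ : ℂ) := by fun_prop
  rw [intervalIntegral.integral_const_mul, intervalIntegral.integral_sub, hA, hB]
  · linear_combination (Real.pi * q η) * Complex.I_sq
  · exact ((hqcont.mul hsinc).div hDcont hD).intervalIntegrable _ _
  · exact (((Complex.continuous_conj.comp hqcont).mul hsinc).div hDcont hD).intervalIntegrable _ _

/-- A finite measure as a sum of a point mass at `0` and of the image of a continuous density on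
`(0, 2π]` under a bounded continuous map, and its Cauchy transform. -/
theorem exists_measure_dirac_add_map {m M : ℝ} (hm : 0 ≤ m) {ρ τ : ℝ → ℝ} (hρ : Continuous ρ)
    (hρ0 : ∀ θ, 0 ≤ ρ θ) (hτ : Continuous τ) (hM : ∀ θ, |τ θ| ≤ M) :
    ∃ μ : Measure ℝ, IsFiniteMeasure μ ∧ (∀ᵐ t ∂μ, |t| ≤ M) ∧
      ∀ w : ℂ, (∀ θ, w - τ θ ≠ 0) → cauchyTransform μ w =
        m / w + ∫ θ in (0 : ℝ)..2 * Real.pi, (ρ θ : ℂ) * (1 / (w - τ θ)) := by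
  set ν : Measure ℝ := volume.restrict (Set.Ioc 0 (2 * Real.pi))
  set ν' : Measure ℝ := ν.withDensity fun θ => ENNReal.ofReal (ρ θ)
  have hν' : IsFiniteMeasure ν' := isFiniteMeasure_withDensity_ofReal hρ.integrableOn_Ioc.2
  have hτm : AEMeasurable τ ν' := hτ.measurable.aemeasurable
  refine ⟨ENNReal.ofReal m • Measure.dirac 0 + ν'.map τ, ?_, ?_, ?_⟩
  · have : IsFiniteMeasure (ENNReal.ofReal m • Measure.dirac (0 : ℝ)) :=
      Measure.smul_finite _ ENNReal.ofReal_ne_top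
    infer_instance
  · have hmeas : MeasurableSet {t : ℝ | |t| ≤ M} := measurableSet_le (by fun_prop) (by fun_prop)
    rw [ae_add_measure_iff]
    constructor
    · refine Measure.ae_smul_measure ?_ _
      rw [ae_dirac_iff hmeas, abs_zero]
      exact (abs_nonneg _).trans (hM 0)
    · rw [ae_map_iff hτm hmeas]
      exact Eventually.of_forall hM
  · intro w hw
    have hmeas : Measurable fun t : ℝ => 1 / (w - (t : ℂ)) := by fun_prop
    have hcont : Continuous fun θ => 1 / (w - (τ θ : ℂ)) :=
      continuous_const.div (by fun_prop) hw
    have hdm : Measurable fun θ => ENNReal.ofReal (ρ θ) := by fun_prop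
    have hint : Integrable (fun θ => 1 / (w - (τ θ : ℂ))) ν' := by
      rw [integrable_withDensity_iff_integrable_smul' hdm (by simp)]
      simp_rw [ENNReal.toReal_ofReal (hρ0 _)]
      exact (hρ.smul hcont).integrableOn_Ioc
    rw [cauchyTransform, integral_add_measure, integral_smul_measure, integral_dirac,
      integral_map hτm hmeas.aestronglyMeasurable,
      integral_withDensity_eq_integral_toReal_smul hdm (by simp),
      intervalIntegral.integral_of_le (by positivity)]
    · congr 1
      · rw [ENNReal.toReal_ofReal hm, Complex.ofReal_zero, sub_zero, Complex.real_smul, mul_one_div]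
      · refine integral_congr_ae (Eventually.of_forall fun θ => ?_)
        simp only [ENNReal.toReal_ofReal (hρ0 θ), Complex.real_smul]
    · exact (integrable_dirac (by simp)).smul_measure ENNReal.ofReal_ne_top
    · exact (integrable_map_measure hmeas.aestronglyMeasurable hτm).2 hint

/-- If `Z` is, in the Joukowski coordinate `x = A + B (η + 1 / η)` of the complement of
`[A - 2 B, A + 2 B] ⊆ (0, ∞)`, a function with a simple pole at `η = 0` whose imaginary part is
nonpositive on the upper unit semicircle, and if `Z` vanishes where `x` does, then
`Z = G_μ(1 / x)` for a finite measure `μ` of bounded support: the boundary values of `Im Z` on the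
unit circle give the density of `μ` off `0`, and the pole of `Z` gives an atom of `μ` at `0`. -/
theorem exists_measure_cauchyTransform_joukowski {R : ℝ} (hR : 1 < R) {Q : ℂ → ℂ}
    (hQ : DifferentiableOn ℂ Q (ball 0 R)) (hQs : ConjEquivariantOn Q R) {c A B : ℝ} (hc : 0 ≤ c)
    (hB : 0 < B) (hAB : 2 * B < A)
    (him : ∀ ζ : ℂ, ‖ζ‖ = 1 → 0 ≤ ζ.im → (c / ζ + Q ζ).im ≤ 0)
    {η₀ : ℂ} (hη₀ : η₀ ≠ 0) (hη₀1 : ‖η₀‖ < 1) (hx₀ : A + B * (η₀ + 1 / η₀) = 0)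
    (hZ₀ : c / η₀ + Q η₀ = 0) :
    ∃ (μ : Measure ℝ) (M : ℝ), IsFiniteMeasure μ ∧ (∀ᵐ t ∂μ, |t| ≤ M) ∧
      ∀ η : ℂ, η ≠ 0 → ‖η‖ < 1 → A + B * (η + 1 / η) ≠ 0 →
        cauchyTransform μ (1 / (A + B * (η + 1 / η))) = c / η + Q η := by
  have hball : ∀ θ : ℝ, circleMap 0 1 θ ∈ ball (0 : ℂ) R := fun θ => by
    rw [mem_ball_zero_iff, norm_circleMap_zero_one]; exact hR
  have h0mem : ((0 : ℝ) : ℂ) ∈ ball (0 : ℂ) R := by simp; linarith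
  have hBC : (B : ℂ) ≠ 0 := by exact_mod_cast hB.ne'
  set q : ℂ → ℂ := fun ζ => Q ζ - c * ζ - Q 0 with hq
  have hqd : DifferentiableOn ℂ q (ball 0 R) := (hQ.sub (by fun_prop)).sub_const _
  have hqs : ConjEquivariantOn q R := fun ζ hζ => by
    have := hQs _ h0mem
    simp only [Complex.ofReal_zero, map_zero] at this
    simp [hq, hQs ζ hζ, ← this]
  have hq0 : q 0 = 0 := by simp [hq]
  have hqcont : Continuous fun θ : ℝ => q (circleMap 0 1 θ) :=
    hqd.continuousOn.comp_continuous (continuous_circleMap 0 1) hball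
  have hqim : ∀ ζ : ℂ, ‖ζ‖ = 1 → 0 ≤ ζ.im → (q ζ).im ≤ 0 := by
    intro ζ hζ hi
    have h1 := him ζ hζ hi
    have h2 : (Q 0).im = 0 := by
      have := hQs.im_ofReal h0mem
      rwa [Complex.ofReal_zero] at this
    have h3 : 1 / ζ = conj ζ := by
      rw [one_div, Complex.inv_def, Complex.normSq_eq_norm_sq, hζ]
      simp
    rw [← mul_one_div, h3] at h1
    simp [hq, h2] at h1 ⊢
    linarith
  have hsign : ∀ θ : ℝ, (q (circleMap 0 1 θ)).im * Real.sin θ ≤ 0 := by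
    intro θ
    have hi : (circleMap 0 1 θ).im = Real.sin θ := by
      rw [circleMap_zero_one_eq]
      simp [-Complex.ofReal_cos, -Complex.ofReal_sin]
    rcases le_total 0 (Real.sin θ) with h | h
    · exact mul_nonpos_of_nonpos_of_nonneg
        (hqim _ (norm_circleMap_zero_one θ) (by rw [hi]; exact h)) h
    · have h1 := hqim (conj (circleMap 0 1 θ)) (by rw [Complex.norm_conj, norm_circleMap_zero_one])
        (by rw [Complex.conj_im, hi]; linarith)
      rw [hqs _ (hball θ), Complex.conj_im] at h1
      exact mul_nonpos_of_nonneg_of_nonpos (by linarith) h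
  have hs : ∀ θ : ℝ, A - 2 * B ≤ A + 2 * B * Real.cos θ := fun θ => by
    nlinarith [Real.neg_one_le_cos θ]
  have hs0 : ∀ θ : ℝ, 0 < A + 2 * B * Real.cos θ := fun θ => by linarith [hs θ]
  have hscont : Continuous fun θ : ℝ => A + 2 * B * Real.cos θ := by fun_prop
  obtain ⟨μ, hμ, hμM, hG⟩ := exists_measure_dirac_add_map (m := c / B) (M := 1 / (A - 2 * B))
    (ρ := fun θ => -(B / Real.pi) * ((q (circleMap 0 1 θ)).im * Real.sin θ) /
      (A + 2 * B * Real.cos θ) ^ 2) (τ := fun θ => 1 / (A + 2 * B * Real.cos θ))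
    (by positivity)
    (by
      refine Continuous.div (continuous_const.mul ((Complex.continuous_im.comp hqcont).mul
        Real.continuous_sin)) (hscont.pow 2) fun θ => (pow_pos (hs0 θ) 2).ne')
    (fun θ => div_nonneg (mul_nonneg_of_nonpos_of_nonpos
      (neg_nonpos.2 (div_nonneg hB.le Real.pi_pos.le)) (hsign θ)) (sq_nonneg _))
    (continuous_const.div hscont fun θ => (hs0 θ).ne')
    (fun θ => by
      rw [abs_of_pos (one_div_pos.2 (hs0 θ))]
      exact one_div_le_one_div_of_le (by linarith) (hs θ))
  refine ⟨μ, _, hμ, hμM, fun η hη hη1 hx => ?_⟩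
  -- With `x = A + B (η + 1 / η)` and `s = A + 2 B cos θ`, the formula for `q` reads
  -- `q η = ∫ d / (s - x)`; the vanishing at `η₀` turns the kernel into `1 / (s - x) - 1 / s`.
  have hint : ∀ y : ℂ, y ≠ 0 → ‖y‖ < 1 → IntervalIntegrable (fun θ : ℝ =>
      (((q (circleMap 0 1 θ)).im * Real.sin θ : ℝ) : ℂ) / (2 * (Real.cos θ : ℂ) - (y + 1 / y)))
      volume 0 (2 * Real.pi) := by
    intro y hy hy1
    refine Continuous.intervalIntegrable (Continuous.div ?_ (by fun_prop)
      (two_cos_sub_ne_zero hy hy1)) _ _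
    exact Complex.continuous_ofReal.comp ((Complex.continuous_im.comp hqcont).mul
        Real.continuous_sin)
  have hqη := integral_im_mul_sin_div hR hqd hqs hq0 hη hη1
  have hqη₀ := integral_im_mul_sin_div hR hqd hqs hq0 hη₀ hη₀1
  set x : ℂ := A + B * (η + 1 / η) with hxdef
  have hsx : ∀ θ : ℝ, ((A + 2 * B * Real.cos θ : ℝ) : ℂ) - x =
      B * (2 * (Real.cos θ : ℂ) - (η + 1 / η)) := by
    intro θ
    rw [hxdef]
    push_cast
    ring
  have hsx₀ : ∀ θ : ℝ, ((A + 2 * B * Real.cos θ : ℝ) : ℂ) =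
      B * (2 * (Real.cos θ : ℂ) - (η₀ + 1 / η₀)) := by
    intro θ
    push_cast
    linear_combination hx₀
  have hsC : ∀ θ : ℝ, ((A + 2 * B * Real.cos θ : ℝ) : ℂ) ≠ 0 := fun θ => by
    exact_mod_cast (hs0 θ).ne'
  have hsx0 : ∀ θ : ℝ, ((A + 2 * B * Real.cos θ : ℝ) : ℂ) - x ≠ 0 := fun θ => by
    rw [hsx]
    exact mul_ne_zero hBC (two_cos_sub_ne_zero hη hη1 θ)
  have hker : ∀ θ : ℝ, 1 / x - ((1 / (A + 2 * B * Real.cos θ) : ℝ) : ℂ) =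
      (((A + 2 * B * Real.cos θ : ℝ) : ℂ) - x) / (x * ((A + 2 * B * Real.cos θ : ℝ) : ℂ)) := by
    intro θ
    have h1 := hsC θ
    rw [Complex.ofReal_div, Complex.ofReal_one]
    field_simp
  rw [hG (1 / x) fun θ => by
    rw [hker]
    exact div_ne_zero (hsx0 θ) (mul_ne_zero hx (hsC θ))]
  have hpt : ∀ θ : ℝ, ((-(B / Real.pi) * ((q (circleMap 0 1 θ)).im * Real.sin θ) /
      (A + 2 * B * Real.cos θ) ^ 2 : ℝ) : ℂ) *
      (1 / (1 / x - ((1 / (A + 2 * B * Real.cos θ) : ℝ) : ℂ))) =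
      (-1 / Real.pi) * ((((q (circleMap 0 1 θ)).im * Real.sin θ : ℝ) : ℂ) /
          (2 * (Real.cos θ : ℂ) - (η + 1 / η)) -
        (((q (circleMap 0 1 θ)).im * Real.sin θ : ℝ) : ℂ) /
          (2 * (Real.cos θ : ℂ) - (η₀ + 1 / η₀))) := by
    intro θ
    have e1 : 2 * (Real.cos θ : ℂ) - (η + 1 / η) =
        (((A + 2 * B * Real.cos θ : ℝ) : ℂ) - x) / B := by
      rw [hsx]; field_simp
    have e2 : 2 * (Real.cos θ : ℂ) - (η₀ + 1 / η₀) =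
        ((A + 2 * B * Real.cos θ : ℝ) : ℂ) / B := by
      rw [hsx₀]; field_simp
    rw [hker, e1, e2, Complex.ofReal_div, Complex.ofReal_pow, Complex.ofReal_mul,
      Complex.ofReal_neg, Complex.ofReal_div]
    have h1 := hsC θ
    have h2 := hsx0 θ
    have hpi : (Real.pi : ℂ) ≠ 0 := by exact_mod_cast Real.pi_ne_zero
    set s : ℂ := ((A + 2 * B * Real.cos θ : ℝ) : ℂ)
    field_simp
    ring
  simp_rw [hpt]
  rw [intervalIntegral.integral_const_mul,
    intervalIntegral.integral_sub (hint η hη hη1) (hint η₀ hη₀ hη₀1), hqη, hqη₀]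
  have hpi : (Real.pi : ℂ) ≠ 0 := by exact_mod_cast Real.pi_ne_zero
  have hfin : (-1 / Real.pi : ℂ) * (-Real.pi * q η - -Real.pi * q η₀) = q η - q η₀ := by
    field_simp
    ring
  have hη₀' : c * (η₀ + 1 / η₀) = c / B * -A := by
    field_simp
    field_simp at hx₀
    linear_combination c * hx₀
  rw [hfin, div_div_eq_mul_div, div_one, hxdef, Complex.ofReal_div]
  simp only [hq]
  have e3 : (c : ℂ) / B * (A + B * (η + 1 / η)) = c / B * A + c * η + c / η := by
    field_simp
    ring
  rw [e3]
  have e4 : (c : ℂ) * η₀ + c / η₀ = c / B * -A := by rw [← hη₀']; ring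
  linear_combination e4 - hZ₀

/-! ### The total mass -/

/-- The mass is `1` because the Cauchy transform of a finite measure of
bounded support is `μ(ℝ) / w + o(1 / w)` at infinity, while `w = 1 / z + R z` gives `z * w → 1`. -/
theorem isProbabilityMeasure_of_cauchyTransform {μ : Measure ℝ} [IsFiniteMeasure μ] {M : ℝ}
    (hM : ∀ᵐ t ∂μ, |t| ≤ M) {R : ℂ → ℂ} (hR : ContinuousAt R 0)
    (h : ∀ᶠ z in 𝓝[≠] (0 : ℂ), cauchyTransform μ (1 / z + R z) = z) :
    IsProbabilityMeasure μ := by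
  have hzR : Tendsto (fun z : ℂ => 1 + z * R z) (𝓝[≠] 0) (𝓝 1) := by
    have : ContinuousAt (fun z : ℂ => 1 + z * R z) 0 := by fun_prop
    simpa using this.tendsto.mono_left nhdsWithin_le_nhds
  have hlim : Tendsto (fun z : ℂ => z * (1 / z + R z)) (𝓝[≠] 0) (𝓝 1) := by
    refine hzR.congr' ?_
    filter_upwards [self_mem_nhdsWithin] with z hz
    have : z ≠ 0 := hz
    field_simp
  have hint : Tendsto (fun z : ℂ => ∫ t : ℝ, (1 + z * R z) / ((1 + z * R z) - z * t) ∂μ)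
      (𝓝[≠] 0) (𝓝 (∫ _ : ℝ, (1 : ℂ) ∂μ)) := by
    have hid : Tendsto (fun z : ℂ => z) (𝓝[≠] 0) (𝓝 0) := tendsto_id.mono_left nhdsWithin_le_nhds
    have hsmall : ∀ᶠ z : ℂ in 𝓝[≠] 0, ‖z‖ * M < 1 / 4 := by
      have : Tendsto (fun z : ℂ => ‖z‖ * M) (𝓝[≠] 0) (𝓝 0) := by
        simpa using hid.norm.mul_const M
      exact this.eventually (gt_mem_nhds (by norm_num))
    have hnear : ∀ᶠ z : ℂ in 𝓝[≠] 0, ‖1 + z * R z - 1‖ < 1 / 4 := by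
      have := (hzR.sub_const 1).norm
      rw [sub_self, norm_zero] at this
      exact this.eventually (gt_mem_nhds (by norm_num))
    refine tendsto_integral_filter_of_dominated_convergence (fun _ => 4) ?_ ?_
      (integrable_const _) ?_
    · refine Eventually.of_forall fun z => Measurable.aestronglyMeasurable ?_
      fun_prop
    · filter_upwards [hsmall, hnear] with z h1 h2
      filter_upwards [hM] with t ht
      have h3 : ‖z * t‖ ≤ 1 / 4 := by
        rw [norm_mul, Complex.norm_real, Real.norm_eq_abs]
        exact (mul_le_mul_of_nonneg_left ht (norm_nonneg _)).trans h1.le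
      have h4 : ‖1 + z * R z‖ ≤ 2 := by
        have := norm_add_le (1 + z * R z - 1) 1
        rw [sub_add_cancel, norm_one] at this
        linarith
      have h5 : 1 / 2 ≤ ‖1 + z * R z - z * t‖ := by
        have e1 := norm_sub_norm_le (1 : ℂ) (-(1 + z * R z - 1) + z * t)
        have e2 := norm_add_le (-(1 + z * R z - 1)) (z * t)
        rw [norm_neg] at e2
        have e3 : (1 : ℂ) - (-(1 + z * R z - 1) + z * t) = 1 + z * R z - z * t := by ring
        rw [e3, norm_one] at e1
        linarith
      rw [norm_div, div_le_iff₀ (by linarith)]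
      linarith
    · refine Eventually.of_forall fun t => ?_
      have := hzR.div (hzR.sub (hid.mul_const (t : ℂ))) (by simp)
      rw [zero_mul, sub_zero, div_one] at this
      exact this
  have hmass : ∫ _ : ℝ, (1 : ℂ) ∂μ = 1 := by
    refine tendsto_nhds_unique (hint.congr' ?_) hlim
    filter_upwards [h, self_mem_nhdsWithin] with z hz hz0
    have hz0 : z ≠ 0 := hz0
    conv_rhs => rw [mul_comm]; arg 2; rw [← hz]
    rw [cauchyTransform, ← integral_const_mul]
    congr 1
    ext t
    have e1 : 1 + z * R z = z * (1 / z + R z) := by field_simp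
    rw [e1, ← mul_sub, mul_div_mul_left _ _ hz0, mul_one_div]
  rw [integral_const, Complex.real_smul, mul_one] at hmass
  have : μ.real Set.univ = 1 := by exact_mod_cast hmass
  exact ⟨by rw [← ENNReal.toReal_eq_one_iff]; exact this⟩

/-! ### Perturbations of the free Poisson R-transform -/

/-- The construction of the measure in the disc coordinate: if `P` is close to
`v ^ 2 + a * v + 1`, then near a common zero `v₀` of `P` and of `a₀ + b / v` the function
`a₀ + b / v` is the Cauchy transform of a finite measure at the point `v / (β P v)`. -/
theorem exists_measure_of_near_quadratic {R a β a₀ b : ℝ} (hR : 1 < R) (ha : 2 < a) (hβ : 0 < β)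
    (hb : 0 < b) {v₀ : ℂ} (hv₀ : v₀ ≠ 0) (hv₀1 : ‖v₀‖ < 1) (hz₀ : (a₀ : ℂ) + b / v₀ = 0) :
    ∃ ε > 0, ∀ P : ℂ → ℂ, DifferentiableOn ℂ P (ball 0 R) → ConjEquivariantOn P R →
      (∀ v ∈ ball (0 : ℂ) R, ‖P v - (v ^ 2 + a * v + 1)‖ ≤ ε) → P v₀ = 0 →
      ∃ (μ : Measure ℝ) (M : ℝ), IsFiniteMeasure μ ∧ (∀ᵐ t ∂μ, |t| ≤ M) ∧
        ∀ᶠ v in 𝓝 v₀, P v ≠ 0 → cauchyTransform μ (v / (β * P v)) = a₀ + b / v := by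
  obtain ⟨R₁, hR₁, hR₁R⟩ : ∃ R₁, 1 < R₁ ∧ R₁ < min R 2 :=
    exists_between (lt_min hR one_lt_two)
  obtain ⟨R₂, hR₂, δ, hδ, hinv⟩ := exists_inverse_of_div_near_one hR₁
  obtain ⟨d, hd0, hdδ, hd2, hda, hdv⟩ : ∃ d > 0, d ≤ δ ∧ d ≤ 1 / 2 ∧ 4 * d ≤ a - 2 ∧
      2 * d ≤ 1 - ‖v₀‖ := by
    refine ⟨min δ (min (1 / 2) (min ((a - 2) / 4) ((1 - ‖v₀‖) / 2))), ?_, min_le_left _ _,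
      (min_le_right _ _).trans (min_le_left _ _), ?_, ?_⟩
    · have h1 : 0 < (a - 2) / 4 := by linarith
      have h2 : 0 < (1 - ‖v₀‖) / 2 := by linarith
      positivity
    · have := (min_le_right δ _).trans ((min_le_right (1 / 2) _).trans
        (min_le_left ((a - 2) / 4) ((1 - ‖v₀‖) / 2)))
      linarith
    · have := (min_le_right δ _).trans ((min_le_right (1 / 2) _).trans
        (min_le_right ((a - 2) / 4) ((1 - ‖v₀‖) / 2)))
      linarith
  obtain ⟨ε, hε, hfac⟩ := exists_joukowski_factor hR₁ (hR₁R.trans_le (min_le_left _ _))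
    (hR₁R.trans_le (min_le_right _ _)).le a hd0
  refine ⟨ε, hε, fun P hP hPs hclose hPv₀ => ?_⟩
  obtain ⟨A, B, S, hA, hB, hS, hSs, hS1, hPS⟩ := hfac P hP hPs hclose
  obtain ⟨Φ, hΦ, hΦs, hΦeq, hΦim, hΦinv⟩ := hinv S hS hSs fun v hv => (hS1 v hv).trans hdδ
  rw [abs_le] at hA hB
  have hSlow : ∀ v ∈ ball (0 : ℂ) R₁, 1 - d ≤ ‖S v‖ := by
    intro v hv
    have h1 := norm_sub_norm_le (1 : ℂ) (1 - S v)
    rw [sub_sub_cancel, norm_one, norm_sub_rev] at h1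
    linarith [hS1 v hv]
  have hS0 : ∀ v ∈ ball (0 : ℂ) R₁, S v ≠ 0 := fun v hv => by
    have := hSlow v hv
    exact norm_pos_iff.1 (by linarith)
  -- In the coordinate `η` the function `a₀ + b / v` is `a₀ + b * T η / η`.
  set T : ℂ → ℂ := fun y => 1 / S (Φ y) with hT
  have hTd : DifferentiableOn ℂ T (ball 0 R₂) :=
    DifferentiableOn.div (by fun_prop) (hS.comp hΦ fun y hy => (hΦeq y hy).1)
      fun y hy => hS0 _ (hΦeq y hy).1
  have hTs : ConjEquivariantOn T R₂ := fun y hy => by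
    simp [hT, hΦs y hy, hSs _ (hΦeq y hy).1]
  have h0mem : ((0 : ℝ) : ℂ) ∈ ball (0 : ℂ) R₂ := by simp; linarith
  have hT0 : (((T 0).re : ℝ) : ℂ) = T 0 := by simpa using hTs.ofReal_re h0mem
  have hT0re : 0 ≤ (T 0).re := by
    have h1 : ‖S (Φ 0) - 1‖ ≤ d := hS1 _ (hΦeq 0 (by simpa using h0mem)).1
    have h2 := (abs_le.1 ((Complex.abs_re_le_norm _).trans h1)).1
    rw [Complex.sub_re, Complex.one_re] at h2
    simp only [hT, one_div, Complex.inv_re]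
    exact div_nonneg (by linarith) (Complex.normSq_nonneg _)
  have hQd : DifferentiableOn ℂ (fun y => a₀ + b * dslope T 0 y) (ball 0 R₂) :=
    (((Complex.differentiableOn_dslope (isOpen_ball.mem_nhds (by simpa using h0mem))).2
      hTd).const_mul _).const_add _
  have hQs : ConjEquivariantOn (fun y => a₀ + b * dslope T 0 y) R₂ := fun y hy => by
    have := hTs.dslope h0mem y hy
    rw [Complex.ofReal_zero] at this
    simp [this]
  have hZ : ∀ y ∈ ball (0 : ℂ) R₂, y ≠ 0 →
      ((b * (T 0).re : ℝ) : ℂ) / y + (a₀ + b * dslope T 0 y) = a₀ + b / Φ y := by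
    intro y hy hy0
    have h1 := sub_smul_dslope T 0 y
    rw [sub_zero, smul_eq_mul] at h1
    have h2 : b / Φ y = b * T y / y := by
      have h3 := hS0 _ (hΦeq y hy).1
      conv_lhs => rw [(hΦeq y hy).2]
      simp only [hT]
      field_simp
    rw [h2, Complex.ofReal_mul, hT0]
    field_simp
    linear_combination b * h1
  have hx : ∀ v ∈ ball (0 : ℂ) R₁, v ≠ 0 →
      ((β * A : ℝ) : ℂ) + ((β * B : ℝ) : ℂ) * (v / S v + 1 / (v / S v)) = β * P v / v := by
    intro v hv hv0
    have h1 := hS0 v hv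
    have h2 := hPS v hv
    push_cast
    field_simp
    linear_combination (-β : ℂ) * h2
  -- The points that are close enough to `v₀` for the conclusion.
  have hdisc : ∀ v : ℂ, ‖v‖ < 1 - d → v ∈ ball (0 : ℂ) R₁ ∧ ‖v / S v‖ < 1 ∧ Φ (v / S v) = v := by
    intro v hv
    have hvR : v ∈ ball (0 : ℂ) R₁ := by rw [mem_ball_zero_iff]; linarith
    have hlt : ‖v / S v‖ < 1 := by
      have h1 := hSlow v hvR
      rw [norm_div, div_lt_one (by linarith)]
      linarith
    exact ⟨hvR, hlt, hΦinv v (by linarith) hlt.le⟩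
  obtain ⟨hv₀R, hη₀, hΦ₀⟩ := hdisc v₀ (by linarith)
  have hη₀R : v₀ / S v₀ ∈ ball (0 : ℂ) R₂ := by rw [mem_ball_zero_iff]; linarith
  have hη₀0 : v₀ / S v₀ ≠ 0 := div_ne_zero hv₀ (hS0 _ hv₀R)
  obtain ⟨μ, M, hμ, hM, hG⟩ := exists_measure_cauchyTransform_joukowski hR₂ hQd hQs
    (c := b * (T 0).re) (A := β * A) (B := β * B) (by positivity)
    (mul_pos hβ (by linarith)) (by nlinarith)
    (by
      intro ζ hζ hi
      have hζR : ζ ∈ ball (0 : ℂ) R₂ := by rw [mem_ball_zero_iff, hζ]; exact hR₂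
      have hζ0 : ζ ≠ 0 := by
        rintro rfl
        norm_num at hζ
      rw [hZ ζ hζR hζ0, Complex.add_im, Complex.ofReal_im, zero_add, div_eq_mul_inv,
        Complex.im_ofReal_mul, Complex.inv_im]
      exact mul_nonpos_of_nonneg_of_nonpos hb.le
        (div_nonpos_of_nonpos_of_nonneg (neg_nonpos.2 (hΦim ζ hζR hi)) (Complex.normSq_nonneg _)))
    hη₀0 hη₀ (by rw [hx v₀ hv₀R hv₀, hPv₀, mul_zero, zero_div])
    (by rw [hZ _ hη₀R hη₀0, hΦ₀, hz₀])
  refine ⟨μ, M, hμ, hM, ?_⟩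
  have hn : ∀ᶠ v in 𝓝 v₀, ‖v‖ < 1 - d :=
    continuous_norm.continuousAt.eventually (gt_mem_nhds (by linarith))
  filter_upwards [hn, isOpen_ne.mem_nhds hv₀] with v hv hv0 hPv
  obtain ⟨hvR, hη, hΦv⟩ := hdisc v hv
  have hv0 : v ≠ 0 := hv0
  have hηR : v / S v ∈ ball (0 : ℂ) R₂ := by rw [mem_ball_zero_iff]; linarith
  have hη0 : v / S v ≠ 0 := div_ne_zero hv0 (hS0 _ hvR)
  have hβC : (β : ℂ) ≠ 0 := by exact_mod_cast hβ.ne'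
  have h1 := hG (v / S v) hη0 hη (by
    rw [hx v hvR hv0]
    exact div_ne_zero (mul_ne_zero hβC hPv) hv0)
  rw [hx v hvR hv0, hZ _ hηR hη0, hΦv, one_div_div] at h1
  exact h1

lemma add_div_mem_exteriorDomain {lam r : ℝ} (hr0 : 0 < r) {b : ℝ} (hb : 0 < b)
    {v : ℂ} (hv : v ∈ ball (0 : ℂ) (b / r)) (hv0 : v ≠ 0) :
    ((1 / (1 - lam) : ℝ) : ℂ) + b / v ∈ exteriorDomain lam r := by
  have hn : 0 < ‖v‖ := norm_pos_iff.2 hv0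
  have hv := mem_ball_zero_iff.1 hv
  rw [lt_div_iff₀ hr0] at hv
  have h1 : ((1 / (1 - lam) : ℝ) : ℂ) + b / v - 1 / (1 - (lam : ℂ)) = b / v := by
    push_cast
    ring
  rw [exteriorDomain, Set.mem_ofPred_eq, h1, norm_div, Complex.norm_real,
    Real.norm_of_nonneg hb.le, lt_div_iff₀ hn]
  linarith

/-- In the coordinate `v` with `z = 1 / (1 - lam) + b / v`, which sends the exterior domain to a
punctured disc, an admissible function is `v * ψ v` with `ψ` analytic on the whole disc and bounded
by any bound for the function itself, by the maximum principle on the circle of radius `R > 1`. -/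
theorem IsAdmissible.exists_eq_mul {lam r : ℝ} (hr0 : 0 < r) {b R ε : ℝ}
    (hb : 0 < b) (hR : 1 < R) (hRb : R < b / r) {f : ℂ → ℂ} (hf : IsAdmissible lam r f)
    (hε : ∀ z ∈ exteriorDomain lam r, ‖f z‖ ≤ ε) :
    ∃ ψ : ℂ → ℂ, DifferentiableOn ℂ ψ (ball 0 R) ∧ ConjEquivariantOn ψ R ∧
      (∀ v ∈ ball (0 : ℂ) R, ‖ψ v‖ ≤ ε) ∧
      ∀ v ∈ ball (0 : ℂ) R, v ≠ 0 → f (((1 / (1 - lam) : ℝ) : ℂ) + b / v) = v * ψ v := by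
  obtain ⟨a₀, ha₀⟩ : ∃ a₀ : ℝ, a₀ = 1 / (1 - lam) := ⟨_, rfl⟩
  have hmem : ∀ v ∈ ball (0 : ℂ) (b / r), v ≠ 0 → (a₀ : ℂ) + b / v ∈ exteriorDomain lam r := by
    intro v hv hv0
    rw [ha₀]
    exact add_div_mem_exteriorDomain hr0 hb hv hv0
  rw [← ha₀]
  set φ : ℂ → ℂ := Function.update (fun v => f (a₀ + b / v)) 0 0 with hφ
  have hφ0 : φ 0 = 0 := by simp [hφ]
  have hφne : ∀ v, v ≠ 0 → φ v = f (a₀ + b / v) := fun v hv => by simp [hφ, hv]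
  have hbr : 0 < b / r := by positivity
  have h0mem : ((0 : ℝ) : ℂ) ∈ ball (0 : ℂ) (b / r) := by simpa using hbr
  have hnhds : ball (0 : ℂ) (b / r) ∈ 𝓝 (0 : ℂ) := ball_mem_nhds _ hbr
  have hφd : DifferentiableOn ℂ φ (ball 0 (b / r)) := by
    rw [← Complex.differentiableOn_compl_singleton_and_continuousAt_iff hnhds]
    constructor
    · have h1 : DifferentiableOn ℂ (fun v : ℂ => f (a₀ + b / v)) (ball 0 (b / r) \ {0}) := by
        refine DifferentiableOn.comp (t := exteriorDomain lam r) hf.analytic.differentiableOn ?_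
          fun v hv => hmem v hv.1 hv.2
        exact (DifferentiableOn.div (by fun_prop) (by fun_prop) fun v hv => hv.2).const_add _
      exact h1.congr fun v hv => hφne v hv.2
    · rw [continuousAt_update_same]
      refine hf.tendsto_zero.comp ?_
      have hbC : (b : ℂ) ≠ 0 := by exact_mod_cast hb.ne'
      have h1 : Tendsto (fun v : ℂ => v⁻¹) (𝓝[≠] 0) (Bornology.cobounded ℂ) :=
        tendsto_inv₀_nhdsNE_zero
      rw [← tendsto_norm_atTop_iff_cobounded] at h1 ⊢
      have h2 : Tendsto (fun v : ℂ => b * ‖v⁻¹‖ - ‖(a₀ : ℂ)‖) (𝓝[≠] 0) atTop :=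
        tendsto_atTop_add_const_right _ _ (h1.const_mul_atTop hb)
      refine tendsto_atTop_mono (fun v => ?_) h2
      have h3 := norm_sub_norm_le ((b : ℂ) / v) (-a₀)
      rw [sub_neg_eq_add, norm_neg, add_comm, norm_div, Complex.norm_real b,
        Real.norm_of_nonneg hb.le] at h3
      rw [norm_inv, ← div_eq_mul_inv]
      rw [add_comm] at h3
      rw [add_comm]
      linarith
  have hφs : ConjEquivariantOn φ (b / r) := by
    intro v hv
    rcases eq_or_ne v 0 with rfl | hv0
    · simp [hφ0]
    · have hc0 : conj v ≠ 0 := (map_ne_zero _).2 hv0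
      rw [hφne _ hc0, hφne _ hv0, ← hf.symmetric _ (hmem v hv hv0)]
      simp
  have hψeq : ∀ v, v * dslope φ 0 v = φ v := by
    intro v
    have := sub_smul_dslope φ 0 v
    rwa [hφ0, sub_zero, sub_zero, smul_eq_mul] at this
  have hψd : DifferentiableOn ℂ (dslope φ 0) (ball 0 (b / r)) :=
    (Complex.differentiableOn_dslope hnhds).2 hφd
  have hψs : ConjEquivariantOn (dslope φ 0) (b / r) := by
    simpa using hφs.dslope h0mem
  refine ⟨dslope φ 0, hψd.mono (ball_subset_ball hRb.le), hψs.mono hRb.le, ?_, ?_⟩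
  · intro v hv
    have hR0 : R ≠ 0 := by linarith
    have hdc : DiffContOnCl ℂ (dslope φ 0) (ball 0 R) := by
      apply DifferentiableOn.diffContOnCl
      rw [closure_ball _ hR0]
      exact hψd.mono (closedBall_subset_ball hRb)
    refine Complex.norm_le_of_forall_mem_frontier_norm_le isBounded_ball hdc ?_ (subset_closure hv)
    intro w hw
    rw [frontier_ball _ hR0, mem_sphere_zero_iff_norm] at hw
    have hw0 : w ≠ 0 := norm_pos_iff.1 (by linarith)
    have h1 : ‖w * dslope φ 0 w‖ ≤ ε := by
      rw [hψeq, hφne w hw0]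
      exact hε _ (hmem w (by rw [mem_ball_zero_iff]; linarith) hw0)
    rw [norm_mul, hw] at h1
    nlinarith [norm_nonneg (dslope φ 0 w)]
  · intro v _ hv0
    rw [hψeq, hφne v hv0]

/-- With `z = 1 / (1 - s ^ 2) + s / ((1 - s ^ 2) v)`, the function `1 / z + s ^ 2 / (1 - z)` is
`v` divided by a multiple of the quadratic polynomial `v ^ 2 + (1 + s ^ 2) / s * v + 1`. -/
lemma freePoisson_inverse_in_disc_coordinate {s v z : ℂ} (hs : s ≠ 0) (hs1 : 1 - s ^ 2 ≠ 0)
    (hv : v ≠ 0) (hz : z = 1 / (1 - s ^ 2) + s / (1 - s ^ 2) / v) (hz0 : z ≠ 0)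
    (hz1 : 1 - z ≠ 0) :
    v ^ 2 + (1 + s ^ 2) / s * v + 1 ≠ 0 ∧
      v / (s / (1 - s ^ 2) ^ 2 * (v ^ 2 + (1 + s ^ 2) / s * v + 1)) = 1 / z + s ^ 2 / (1 - z) := by
  have e1 : z = (v + s) / ((1 - s ^ 2) * v) := by
    rw [hz]
    field_simp
  have e2 : 1 - z = -s * (s * v + 1) / ((1 - s ^ 2) * v) := by
    rw [e1]
    field_simp
    ring
  have h1 : v + s ≠ 0 := by
    intro h
    rw [h, zero_div] at e1
    exact hz0 e1
  have h2 : s * v + 1 ≠ 0 := by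
    intro h
    rw [h, mul_zero, zero_div] at e2
    exact hz1 e2
  have e3 : v ^ 2 + (1 + s ^ 2) / s * v + 1 = (v + s) * (s * v + 1) / s := by
    field_simp
    ring
  refine ⟨?_, ?_⟩
  · rw [e3]
    exact div_ne_zero (mul_ne_zero h1 h2) hs
  · rw [e3, e2, e1]
    obtain ⟨u, hu⟩ : ∃ u, u = s * v + 1 := ⟨_, rfl⟩
    rw [← hu] at h2 ⊢
    field_simp
    rw [hu]
    ring

theorem exists_forall_isRTransform_of_small {lam r : ℝ} (hlam0 : 0 < lam) (hlam1 : lam < 1)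
    (hr0 : 0 < r) (hr : r < Real.sqrt lam / (1 - lam)) :
    ∃ ε : ℝ, 0 < ε ∧ ∀ f : ℂ → ℂ, IsAdmissible lam r f →
      (∀ z ∈ exteriorDomain lam r, ‖f z‖ < ε) →
      IsRTransformOfCompactlySupported (fun z => (lam : ℂ) / (1 - z) + f z) := by
  obtain ⟨s, hs⟩ : ∃ s : ℝ, s = Real.sqrt lam := ⟨_, rfl⟩
  have hs0 : 0 < s := by rw [hs]; exact Real.sqrt_pos.2 hlam0
  have hsq : s ^ 2 = lam := by rw [hs]; exact Real.sq_sqrt hlam0.le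
  have hs1 : s < 1 := by nlinarith
  have hl : 0 < 1 - lam := by linarith
  rw [← hs] at hr
  obtain ⟨b, hb⟩ : ∃ b : ℝ, b = s / (1 - lam) := ⟨_, rfl⟩
  obtain ⟨a, ha⟩ : ∃ a : ℝ, a = (1 + s ^ 2) / s := ⟨_, rfl⟩
  obtain ⟨β, hβ⟩ : ∃ β : ℝ, β = s / (1 - lam) ^ 2 := ⟨_, rfl⟩
  have hb0 : 0 < b := by rw [hb]; positivity
  have hβ0 : 0 < β := by rw [hβ]; positivity
  have ha2 : 2 < a := by
    rw [ha, lt_div_iff₀ hs0]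
    nlinarith [sq_pos_of_pos (sub_pos.2 hs1)]
  have hsC : (s : ℂ) ≠ 0 := by exact_mod_cast hs0.ne'
  have hlC : (1 : ℂ) - lam ≠ 0 := by
    have : (((1 - lam : ℝ)) : ℂ) ≠ 0 := by exact_mod_cast hl.ne'
    simpa using this
  have hβC : (β : ℂ) ≠ 0 := by exact_mod_cast hβ0.ne'
  have hsqC : (lam : ℂ) = (s : ℂ) ^ 2 := by rw [← hsq]; push_cast; ring
  have haC : (a : ℂ) = (1 + (s : ℂ) ^ 2) / s := by rw [ha]; push_cast; ring
  have hbr : 1 < b / r := by rw [one_lt_div hr0, hb]; exact hr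
  obtain ⟨R, hR1, hRmin⟩ := exists_between (lt_min hbr one_lt_two)
  have hRb : R < b / r := hRmin.trans_le (min_le_left _ _)
  have hR2 : R < 2 := hRmin.trans_le (min_le_right _ _)
  obtain ⟨ε₁, hε₁, hmain⟩ := exists_measure_of_near_quadratic (R := R) (a := a) (β := β)
    (a₀ := 1 / (1 - lam)) (b := b) (v₀ := -s) hR1 ha2 hβ0 hb0 (neg_ne_zero.2 hsC)
    (by rw [norm_neg, Complex.norm_real, Real.norm_of_nonneg hs0.le]; exact hs1)
    (by rw [hb]; push_cast; field_simp; ring)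
  set C : ℝ := 5 + 2 * a with hC
  have hC0 : 0 < C := by linarith
  obtain ⟨ε, hε0, hεC, hε1⟩ : ∃ ε > 0, β * C * ε ≤ 1 / 2 ∧ C * (2 * (β * C * ε)) ≤ ε₁ := by
    refine ⟨min (1 / 2 / (β * C)) (ε₁ / (C * (2 * (β * C)))), by positivity, ?_, ?_⟩
    · have := min_le_left (1 / 2 / (β * C)) (ε₁ / (C * (2 * (β * C))))
      rw [le_div_iff₀ (by positivity)] at this
      linarith
    · have := min_le_right (1 / 2 / (β * C)) (ε₁ / (C * (2 * (β * C))))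
      rw [le_div_iff₀ (by positivity)] at this
      linarith
  refine ⟨ε, hε0, fun f hf hfε => ?_⟩
  obtain ⟨ψ, hψd, hψs, hψε, hψ⟩ := hf.exists_eq_mul hr0 hb0 hR1 hRb fun z hz => (hfε z hz).le
  set P₀ : ℂ → ℂ := fun v => v ^ 2 + a * v + 1 with hP₀
  have hP₀C : ∀ v ∈ ball (0 : ℂ) R, ‖P₀ v‖ ≤ C := by
    intro v hv
    have hv2 : ‖v‖ ≤ 2 := (mem_ball_zero_iff.1 hv).le.trans hR2.le
    refine norm_add₃_le.trans ?_
    rw [norm_pow, norm_mul, norm_one, Complex.norm_real, Real.norm_of_nonneg (by linarith), hC]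
    nlinarith [norm_nonneg v]
  have hw : ∀ v ∈ ball (0 : ℂ) R, ‖β * P₀ v * ψ v‖ ≤ β * C * ε := by
    intro v hv
    rw [norm_mul, norm_mul, Complex.norm_real, Real.norm_of_nonneg hβ0.le]
    have := hP₀C v hv
    have := hψε v hv
    gcongr
  have hden : ∀ v ∈ ball (0 : ℂ) R, 1 / 2 ≤ ‖1 + β * P₀ v * ψ v‖ := by
    intro v hv
    have h1 := norm_sub_norm_le (1 : ℂ) (-(β * P₀ v * ψ v))
    rw [sub_neg_eq_add, norm_neg, norm_one] at h1
    linarith [hw v hv]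
  have hden0 : ∀ v ∈ ball (0 : ℂ) R, 1 + β * P₀ v * ψ v ≠ 0 := fun v hv => by
    have := hden v hv
    exact norm_pos_iff.1 (by linarith)
  -- `v / (β P v)` is the function `1 / z + lam / (1 - z) + f z` in the coordinate `v`.
  obtain ⟨μ, M, hμ, hM, hG⟩ := hmain (fun v => P₀ v / (1 + β * P₀ v * ψ v))
    (by
      have hP₀d : DifferentiableOn ℂ P₀ (ball 0 R) := by fun_prop
      exact hP₀d.div (((hP₀d.const_mul _).mul hψd).const_add _) hden0)
    (fun v hv => by simp [hP₀, hψs v hv])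
    (fun v hv => by
      have h1 := hden0 v hv
      have h2 : P₀ v / (1 + β * P₀ v * ψ v) - P₀ v =
          -(P₀ v * ((β * P₀ v * ψ v) / (1 + β * P₀ v * ψ v))) := by
        generalize β * P₀ v * ψ v = w at h1
        field_simp
        ring
      change ‖P₀ v / (1 + β * P₀ v * ψ v) - P₀ v‖ ≤ ε₁
      rw [h2, norm_neg, norm_mul, norm_div]
      have h3 : ‖β * P₀ v * ψ v‖ / ‖1 + β * P₀ v * ψ v‖ ≤ 2 * (β * C * ε) := by
        rw [div_le_iff₀ (by linarith [hden v hv])]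
        have := hw v hv
        nlinarith [hden v hv, norm_nonneg (β * P₀ v * ψ v)]
      refine le_trans ?_ hε1
      exact mul_le_mul (hP₀C v hv) h3 (by positivity) hC0.le)
    (by
      have : P₀ (-s) = 0 := by
        simp only [hP₀, haC]
        field_simp
        ring
      simp [this])
  have hf0 : AnalyticAt ℂ f 0 := by
    refine hf.analytic 0 ?_
    have h1 : (0 : ℂ) - 1 / (1 - (lam : ℂ)) = ((-(1 / (1 - lam)) : ℝ) : ℂ) := by push_cast; ring
    rw [exteriorDomain, Set.mem_ofPred_eq, h1, Complex.norm_real, norm_neg,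
      Real.norm_of_nonneg (by positivity)]
    exact hr.trans (div_lt_div_of_pos_right hs1 hl)
  have han : AnalyticAt ℂ (fun z => (lam : ℂ) / (1 - z) + f z) 0 :=
    (analyticAt_const.div (analyticAt_const.sub analyticAt_id) (by simp)).add hf0
  have hev : ∀ᶠ z in 𝓝[≠] (0 : ℂ),
      cauchyTransform μ (1 / z + ((lam : ℂ) / (1 - z) + f z)) = z := by
    have hz1 : ContinuousAt (fun z : ℂ => b / (z - ((1 / (1 - lam) : ℝ) : ℂ))) 0 := by
      refine ContinuousAt.div continuousAt_const (by fun_prop) ?_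
      rw [zero_sub, neg_ne_zero, Complex.ofReal_ne_zero]
      positivity
    have hz2 : (b : ℂ) / (0 - ((1 / (1 - lam) : ℝ) : ℂ)) = -s := by
      rw [hb]
      push_cast
      field_simp
      ring
    have hlim : Tendsto (fun z : ℂ => b / (z - ((1 / (1 - lam) : ℝ) : ℂ))) (𝓝[≠] 0) (𝓝 (-s)) := by
      have := hz1.tendsto
      rw [hz2] at this
      exact this.mono_left nhdsWithin_le_nhds
    have hsball : (-s : ℂ) ∈ ball (0 : ℂ) R := by
      rw [mem_ball_zero_iff, norm_neg, Complex.norm_real, Real.norm_of_nonneg hs0.le]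
      linarith
    have hne1 : ∀ᶠ z : ℂ in 𝓝[≠] 0, z ≠ 1 :=
      nhdsWithin_le_nhds (isOpen_ne.mem_nhds zero_ne_one)
    filter_upwards [hlim.eventually hG, hlim.eventually (isOpen_ball.mem_nhds hsball), hne1,
      hlim.eventually (isOpen_ne.mem_nhds (neg_ne_zero.2 hsC)), self_mem_nhdsWithin]
      with z hGz hvR hz1 hv0 hz0
    have hz0 : z ≠ 0 := hz0
    have hv0 : (b : ℂ) / (z - ((1 / (1 - lam) : ℝ) : ℂ)) ≠ 0 := hv0
    obtain ⟨v, hv⟩ : ∃ v : ℂ, v = b / (z - ((1 / (1 - lam) : ℝ) : ℂ)) := ⟨_, rfl⟩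
    rw [← hv] at hGz hvR hv0
    have hzv : z = ((1 / (1 - lam) : ℝ) : ℂ) + b / v := by
      have hbC : (b : ℂ) ≠ 0 := by exact_mod_cast hb0.ne'
      rw [hv, div_div_cancel₀ hbC]
      ring
    obtain ⟨hP0, hK⟩ := freePoisson_inverse_in_disc_coordinate (s := (s : ℂ)) (v := v) (z := z) hsC
      (by rw [← hsqC]; exact hlC) hv0 (by rw [hzv, hb, ← hsqC]; push_cast; ring) hz0
      (sub_ne_zero.2 hz1.symm)
    rw [← haC] at hP0 hK
    have hP0 : P₀ v ≠ 0 := hP0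
    have hβ' : (β : ℂ) = (s : ℂ) / (1 - (s : ℂ) ^ 2) ^ 2 := by rw [hβ, ← hsqC]; push_cast; ring
    rw [← hβ', ← hsqC] at hK
    have hd0 := hden0 v hvR
    have hGv := hGz (div_ne_zero hP0 hd0)
    rw [← hzv] at hGv
    have hfz : f z = v * ψ v := by
      rw [hzv]
      exact hψ v hvR hv0
    have hKf : 1 / z + ((lam : ℂ) / (1 - z) + f z) =
        v / (β * (P₀ v / (1 + β * P₀ v * ψ v))) := by
      rw [← add_assoc, ← hK, hfz]
      change v / (β * P₀ v) + v * ψ v = _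
      field_simp
    rw [hKf, hGv]
  refine ⟨μ, isProbabilityMeasure_of_cauchyTransform hM han.continuousAt hev, ?_, han, hev⟩
  have hsub : μ.support ⊆ Set.Icc (-M) M := by
    refine Measure.support_subset_of_isClosed isClosed_Icc ?_
    filter_upwards [hM] with t ht using abs_le.1 ht
  exact isCompact_Icc.of_isClosed_subset Measure.isClosed_support hsub

theorem mainTheorem1 (lam r : ℝ) (hlam0 : 0 < lam) (hlam1 : lam < 1)
    (hr0 : 0 < r) (hr : r < Real.sqrt lam / (1 - lam)) :
    (∀ f : ℕ → ℂ → ℂ, (∀ n, IsAdmissible lam r (f n)) →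
      TendstoUniformlyOn f (fun _ => 0) atTop (exteriorDomain lam r) →
      ∀ᶠ n in atTop,
        IsRTransformOfCompactlySupported (fun z => (lam : ℂ) / (1 - z) + f n z)) ∧
    (∃ ε : ℝ, 0 < ε ∧ ∀ f : ℂ → ℂ, IsAdmissible lam r f →
      (∀ z ∈ exteriorDomain lam r, ‖f z‖ < ε) →
      IsRTransformOfCompactlySupported (fun z => (lam : ℂ) / (1 - z) + f z)) := by
  obtain ⟨ε, hε, h⟩ := exists_forall_isRTransform_of_small hlam0 hlam1 hr0 hr
  refine ⟨fun f hf hlim => ?_, ε, hε, h⟩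
  filter_upwards [Metric.tendstoUniformlyOn_iff.1 hlim ε hε] with n hn
  refine h (f n) (hf n) fun z hz => ?_
  simpa [dist_eq_norm] using hn z hz
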